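/- **Conventions.** Scalars are in $\mathbb F=\mathbb R$ or $\mathbb C$. For $p\in(0,\infty)$ put $\Phi_p(t)=t^p$ and $\Psi_p(t)=t^p/p$ on $[0,\infty)$; let $\Phi_\infty=\Psi_\infty$ be $0$ on $[0,1]$ and $\infty$ on $(1,\infty)$. An *Orlicz function* is a non-decreasing left-continuous $F\colon[0,\infty)\to[0,\infty]$ with $\lim_{t\to0^+}F(t)=0$ and $\lim_{t\to\infty}F(t)>0$. For a sequence $M=(M_n)_{n=1}^\infty$ of Orlicz functions put $\rho_M(f)=\sum_n M_n(|f(n)|)$ for $f\in\mathbb F^{\mathbb N}$, and let $\ell_M$ be the space of all $f\in\mathbb F^{\mathbb N}$ with $\rho_M(tf)<\infty$ for some $t>0$, with the vector topology whose neighbourhood basis at the origin consists of the sets $\{f\colon \rho_M(f/u)<\varepsilon\}$, $u,\varepsilon>0$. For one Orlicz function $F$, $\ell_F$ is this space for the constant sequence $M_n=F$. For $\boldsymbol P=(p_n)_{n=1}^\infty$ in $(0,\infty]$, the *Bourgin–Nakano space* $\ell_{\boldsymbol P}$ is this space for $M_n=\Phi_{p_n}$; when $\inf_n p_n>0$ its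 topology is given by the quasi-norm $\inf\{t>0\colon \rho_M(f/t)<1\}$. Let $R(\boldsymbol P)\subseteq[0,\infty]$ be the support of the image under $\boldsymbol P$ of the counting measure (that is, the closure of $\{p_n\colon n\in\mathbb N\}$), $\boldsymbol P^-=\min R(\boldsymbol P)$, $\boldsymbol P^+=\max R(\boldsymbol P)$, and let $A(\boldsymbol P)$ be the set of all limit points (cluster points) of the sequence $\boldsymbol P$. For nonempty $R\subseteq(0,\infty]$, let $\mathcal K(R)$ be the closed convex hull in $\mathcal C([0,1])$ of $\{\Psi_p|_{[0,1]}\colon p\in R\}$, and let $\mathcal O(R)$ be the set of all Orlicz functions $F$ for which there are $0<c\le1$, $\varphi\in\mathcal K(R)$ and $a,b\in(0,\infty)$ with $a\,\varphi(t)\le F(t)\le b\,\varphi(t)$ for all $0\le t\le c$. A *sequence space* $\mathbb S$ is a quasi-Banach lattice of sequences in $\mathbb F^{\mathbb N}$ (so if $f\in\mathbb S$ and $|g|\le|f|$, then $g\in\mathbb S$ and $\|g\|\le\|f\|$), continuously included in $\mathbb F^{\mathbb N}$ with the topology of coordinatewise convergence, containing all finitely supported sequences, and for which there is a constant $C$ such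 that, whenever $f_n\in\mathbb S$ converge coordinatewise to $f$ and $L=\limsup_n\|f_n\|<\infty$, we have $f\in\mathbb S$ and $\|f\|\le C L$. It is *subsymmetric* if, for every (strictly) increasing $\pi\colon\mathbb N\to\mathbb N$, the map $f\mapsto f\circ\pi$ is an isometry from $\{f\in\mathbb S\colon f(n)=0 \text{ for } n\notin\pi(\mathbb N)\}$ onto $\mathbb S$. It *embeds* into $\ell_{\boldsymbol P}$ if there is a linear map $\mathbb S\to\ell_{\boldsymbol P}$ that is an isomorphism onto its image. We write $\mathbb S=\ell_F$ if the two spaces consist of the same sequences and have the same topology. **Theorem.** Let $\boldsymbol P=(p_n)_{n=1}^\infty$ be a sequence in $(0,\infty]$ with $\boldsymbol P^->0$ and $\boldsymbol P^+<\infty$. Suppose that a subsymmetric sequence space $\mathbb S$ embeds into $\ell_{\boldsymbol P}$. Then there are $r\in A(\boldsymbol P)$ and an Orlicz function $F$ such that $\mathbb S=\ell_F$ and $F\in\mathcal O(R(\boldsymbol P)\cap[r,s])$ for all $s>r$. -/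

import Mathlib

open Set Filter Topology MeasureTheory
open scoped NNReal ENNReal

noncomputable section

namespace BourginNakano

/-! ### Orlicz functions and Musielak–Orlicz sequence spaces -/

/-- An Orlicz function: a non-decreasing left-continuous map `F : [0,∞) → [0,∞]` with
`F(t) → 0` as `t → 0⁺` and `lim_{t → ∞} F(t) = sup_t F(t) > 0`. -/
structure IsOrlicz (F : ℝ≥0 → ℝ≥0∞) : Prop where
  mono : Monotone F
  left_cont : ∀ t, Tendsto F (𝓝[<] t) (𝓝 (F t))
  zero_right : Tendsto F (𝓝[>] 0) (𝓝 0)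
  sup_pos : 0 < ⨆ t, F t

/-- The modular `ρ_M(g) = ∑ₙ Mₙ(g(n))` of a sequence `M = (Mₙ)` of functions on `[0,∞)`. -/
def modular (M : ℕ → ℝ≥0 → ℝ≥0∞) (g : ℕ → ℝ≥0) : ℝ≥0∞ := ∑' n, M n (g n)

/-- The sequence space `ℓ_M` of all scalar sequences `f` with `ρ_M(t|f|) < ∞` for some
`t ∈ (0,∞)`. -/
def moSpace (𝕜 : Type*) [RCLike 𝕜] (M : ℕ → ℝ≥0 → ℝ≥0∞) : Set (ℕ → 𝕜) :=
  {f | ∃ t : ℝ≥0, 0 < t ∧ modular M (fun n => t * ‖f n‖₊) < ∞}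

/-- The set `u B_M(ε) = {f : ρ_M(|f|/u) < ε}`. When `M` consists of Orlicz functions, these sets
(`u, ε ∈ (0,∞)`) are a neighbourhood basis at the origin for the vector topology of `ℓ_M`. -/
def moBall (𝕜 : Type*) [RCLike 𝕜] (M : ℕ → ℝ≥0 → ℝ≥0∞) (u ε : ℝ≥0) : Set (ℕ → 𝕜) :=
  {f | modular M (fun n => ‖f n‖₊ / u) < ε}

/-- The Luxemburg gauge `inf {t > 0 : ρ_M(|f|/t) < 1}` of `f ∈ ℓ_M`. -/
def luxemburg {𝕜 : Type*} [RCLike 𝕜] (M : ℕ → ℝ≥0 → ℝ≥0∞) (f : ℕ → 𝕜) : ℝ≥0 :=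
  sInf {t : ℝ≥0 | 0 < t ∧ modular M (fun n => ‖f n‖₊ / t) < 1}

/-! ### Variable exponents -/

/-- `Φ_p(t) = t ^ p` for `p ∈ (0,∞]`, with `Φ_∞ = 0` on `[0,1]` and `Φ_∞ = ∞` on `(1,∞)`. -/
def powPhi (p : ℝ≥0∞) (t : ℝ≥0) : ℝ≥0∞ :=
  if p = ∞ then (if t ≤ 1 then 0 else ∞) else (t : ℝ≥0∞) ^ p.toReal

/-- `Ψ_p(t) = t ^ p / p` for `p ∈ (0,∞)`, and `Ψ_∞ = Φ_∞`. -/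
def powPsi (p : ℝ≥0∞) (t : ℝ≥0) : ℝ≥0∞ :=
  if p = ∞ then powPhi ∞ t else powPhi p t / p

/-- The essential range `R(P)` of `P : ℕ → (0,∞]` with respect to the counting measure: the support
in `[0,∞]` of the image measure. -/
def essRange (P : ℕ → ℝ≥0∞) : Set ℝ≥0∞ := (Measure.map P Measure.count).support

/-- The essential range is the closure of the range. -/
theorem essRange_eq_closure (P : ℕ → ℝ≥0∞) : essRange P = closure (Set.range P) := by
  ext x
  rw [essRange, (nhds_basis_opens x).mem_measureSupport, mem_closure_iff]
  have key : ∀ o : Set ℝ≥0∞, IsOpen o →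
      (0 < Measure.map P Measure.count o ↔ (o ∩ Set.range P).Nonempty) := by
    intro o ho
    rw [Measure.map_apply measurable_from_nat ho.measurableSet, pos_iff_ne_zero, ne_eq, Measure.count_eq_zero_iff, ← ne_eq,
      ← Set.nonempty_iff_ne_empty]
    constructor
    · rintro ⟨n, hn⟩
      exact ⟨P n, hn, n, rfl⟩
    · rintro ⟨_, hy, n, rfl⟩
      exact ⟨n, hy⟩
  constructor
  · intro h o ho hx
    exact (key o ho).1 (h o ⟨hx, ho⟩)
  · rintro h o ⟨hx, ho⟩
    exact (key o ho).2 (h o ho hx)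

/-- The set `A(P)` of all limit points (cluster points) in `[0,∞]` of the sequence `P`. -/
def limitPoints (P : ℕ → ℝ≥0∞) : Set ℝ≥0∞ := {r | MapClusterPt r atTop P}

/-- The Musielak–Orlicz sequence `(Φ_{p_n})` of the variable exponent `P = (p_n)`; the
Bourgin–Nakano space `ℓ_P` is `moSpace 𝕜 (varExp P)`, quasi-normed (for `P⁻ > 0`) by
`luxemburg (varExp P)`. -/
def varExp (P : ℕ → ℝ≥0∞) : ℕ → ℝ≥0 → ℝ≥0∞ := fun n => powPhi (P n)

/-! ### Orlicz functions generated near zero by power functions -/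

/-- `K(R)`, for `R ⊆ (0,∞]`: the closed convex hull in `C([0,1])` of the restrictions to `[0,1]` of
the functions `Ψ_p`, `p ∈ R`. -/
def classK (R : Set ℝ≥0∞) : Set C(unitInterval, ℝ) :=
  closedConvexHull ℝ {φ | ∃ p ∈ R, 0 < p ∧
    ∀ t : unitInterval, φ t = (powPsi p (Real.toNNReal (t : ℝ))).toReal}

/-- `O(R)`, for `R ⊆ (0,∞]`: the Orlicz functions `F` for which there are `0 < c ≤ 1` and
`φ ∈ K(R)` with `F(t) ≈ φ(t)` for `0 ≤ t ≤ c`. -/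
def classO (R : Set ℝ≥0∞) : Set (ℝ≥0 → ℝ≥0∞) :=
  {F | IsOrlicz F ∧ ∃ c : ℝ, 0 < c ∧ c ≤ 1 ∧ ∃ φ ∈ classK R, ∃ a b : ℝ, 0 < a ∧ 0 < b ∧
    ∀ t : unitInterval, (t : ℝ) ≤ c →
      ENNReal.ofReal (a * φ t) ≤ F (Real.toNNReal (t : ℝ)) ∧
      F (Real.toNNReal (t : ℝ)) ≤ ENNReal.ofReal (b * φ t)}

/-! ### Sequence spaces -/

/-- A sequence space: a function space over `ℕ` with the counting measure, that is, a quasi-Banach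
lattice of scalar sequences which is continuously included in the space of all sequences (with
coordinatewise convergence), contains the finitely supported sequences, and has the stated
Fatou-type property. In `fatou`, quantifying over all eventual upper bounds `B` of `‖fₙ‖` amounts
to the bound `C limsup ‖fₙ‖`. -/
structure SequenceSpace (𝕜 : Type*) [RCLike 𝕜] where
  carrier : Submodule 𝕜 (ℕ → 𝕜)
  qnorm : carrier → ℝ
  qnorm_nonneg : ∀ f, 0 ≤ qnorm f
  qnorm_eq_zero : ∀ f, qnorm f = 0 ↔ f = 0
  qnorm_smul : ∀ (a : 𝕜) (f), qnorm (a • f) = ‖a‖ * qnorm f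
  qnorm_add : ∃ k : ℝ, ∀ f g, qnorm (f + g) ≤ k * (qnorm f + qnorm g)
  complete : ∀ f : ℕ → carrier,
    (∀ ε : ℝ, 0 < ε → ∃ N, ∀ m ≥ N, ∀ n ≥ N, qnorm (f m - f n) < ε) →
      ∃ g : carrier, Tendsto (fun n => qnorm (f n - g)) atTop (𝓝 0)
  solid : ∀ f ∈ carrier, ∀ g : ℕ → 𝕜, (∀ n, ‖g n‖ ≤ ‖f n‖) → g ∈ carrier
  qnorm_mono : ∀ f g : carrier,
    (∀ n, ‖(g : ℕ → 𝕜) n‖ ≤ ‖(f : ℕ → 𝕜) n‖) → qnorm g ≤ qnorm f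
  coord_cont : ∀ n, ∃ C : ℝ, ∀ f : carrier, ‖(f : ℕ → 𝕜) n‖ ≤ C * qnorm f
  finite_mem : ∀ f : ℕ → 𝕜, (Function.support f).Finite → f ∈ carrier
  fatou : ∃ C : ℝ, 0 ≤ C ∧ ∀ (f : ℕ → carrier) (g : ℕ → 𝕜) (B : ℝ),
    (∀ k, Tendsto (fun n => (f n : ℕ → 𝕜) k) atTop (𝓝 (g k))) →
    (∀ᶠ n in atTop, qnorm (f n) ≤ B) →
      ∃ h : g ∈ carrier, qnorm ⟨g, h⟩ ≤ C * B

namespace SequenceSpace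

variable {𝕜 : Type*} [RCLike 𝕜]

/-- `S` is subsymmetric: for every increasing `π : ℕ → ℕ`, `f ↦ f ∘ π` is an isometry from
`{f ∈ S : supp f ⊆ π(ℕ)}` onto `S`. -/
def IsSubsymmetric (S : SequenceSpace 𝕜) : Prop :=
  ∀ π : ℕ → ℕ, StrictMono π →
    (∀ f : S.carrier, Function.support (f : ℕ → 𝕜) ⊆ Set.range π →
      ∃ h : (f : ℕ → 𝕜) ∘ π ∈ S.carrier, S.qnorm ⟨_, h⟩ = S.qnorm f) ∧
    (∀ g : S.carrier, ∃ f : S.carrier,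
      Function.support (f : ℕ → 𝕜) ⊆ Set.range π ∧ (f : ℕ → 𝕜) ∘ π = g)

/-- `S` embeds into the Bourgin–Nakano space `ℓ_P` (where `P⁻ > 0`): there is a linear map
`T : S → ℓ_P` which is an isomorphism onto its image. -/
def EmbedsInto (S : SequenceSpace 𝕜) (P : ℕ → ℝ≥0∞) : Prop :=
  ∃ T : S.carrier →ₗ[𝕜] (ℕ → 𝕜), (∀ f, T f ∈ moSpace 𝕜 (varExp P)) ∧
    ∃ a b : ℝ, 0 < a ∧ 0 < b ∧ ∀ f,
      a * S.qnorm f ≤ luxemburg (varExp P) (T f) ∧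
      luxemburg (varExp P) (T f) ≤ b * S.qnorm f

/-- `S = ℓ_F` as topological vector spaces: the underlying sets of sequences agree, and so do the
neighbourhoods of the origin. -/
def EqOrlicz (S : SequenceSpace 𝕜) (F : ℝ≥0 → ℝ≥0∞) : Prop :=
  (S.carrier : Set (ℕ → 𝕜)) = moSpace 𝕜 (fun _ => F) ∧
  (∀ u ε : ℝ≥0, 0 < u → 0 < ε → ∃ δ : ℝ, 0 < δ ∧
    ∀ f : S.carrier, S.qnorm f < δ → (f : ℕ → 𝕜) ∈ moBall 𝕜 (fun _ => F) u ε) ∧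
  (∀ δ : ℝ, 0 < δ → ∃ u ε : ℝ≥0, 0 < u ∧ 0 < ε ∧
    ∀ f : S.carrier, (f : ℕ → 𝕜) ∈ moBall 𝕜 (fun _ => F) u ε → S.qnorm f < δ)

end SequenceSpace

end BourginNakano

end

/-! The images under the embedding `T` of the unit vectors of `S` are coordinatewise bounded, so a
subsequence converges coordinatewise, and differences of its terms taken in disjoint pairs give a
coordinatewise null sequence `y n = T (e_{α n} - e_{β n})`. Subsymmetry, solidity and the
quasi-triangle inequality make `∑ a_j (e_{α j} - e_{β j})` equivalent in norm to `∑ a_j e_j`, so it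
is enough to compute the modular of `∑ a_j y_j` along a subsequence.

A gliding hump (`exists_block_approx`) replaces the `y_j` by disjoint blocks `z_j` with summably
small errors. On disjoint blocks the modular is additive: that of `∑ a_j z_j` is `∑ f_j(|a_j|)`,
where `f_j(t) = ∑_k |z_j(k)|^{p_k} t^{p_k}` is a positive combination of powers. The total masses of
these combinations are bounded above and away from zero, so they lie in a compact subset of
`C([0,1])` by Mazur's theorem. A subsequence converges uniformly to some `F`, fast enough for the
errors to be summable, and the modular of `∑ a_j y_j` is controlled by `∑ F(|a_j|)`
(`exists_orlicz_of_null`). Homogeneity and the Fatou property turn this into `S = ℓ_F`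
(`eqOrlicz_of_trunc`).

The exponent `r` is found in `exists_limit_of_weights`. Let `μ(x)` be the limiting mass on exponents
at most `x`, and `r` the infimum of the `x` with `μ(x) > 0`. Since the blocks move to infinity, `r`
is a limit point of the exponents. For `x > r`, mass beyond `x` contributes at most a multiple of
`t^x`, which the positive mass below `x` absorbs; mass below `r` disappears in the limit. Hence `F`
is comparable to an element of `K(R ∩ [r,x])`, with `r` and `F` independent of `x`. -/

namespace BourginNakano

/-! ### Power functions on the unit interval and compactness of `K(R)`. -/

/-- The function `t ↦ t ^ |p|` on `[0,1]`. -/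
noncomputable def powC (p : ℝ) : C(unitInterval, ℝ) :=
  ⟨fun t => (t : ℝ) ^ |p|, by
    exact (Real.continuous_rpow_const (abs_nonneg p)).comp continuous_subtype_val⟩

theorem powC_apply {p : ℝ} (hp : 0 ≤ p) (t : unitInterval) : powC p t = (t : ℝ) ^ p := by
  simp [powC, abs_of_nonneg hp]

theorem continuousOn_powC : ContinuousOn powC (Ioi 0) := by
  rw [continuousOn_iff_continuous_domRestrict]
  apply ContinuousMap.continuous_of_continuous_uncurry
  have : Continuous fun x : Ioi (0 : ℝ) × unitInterval => (x.2 : ℝ) ^ |(x.1 : ℝ)| := by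
    apply Continuous.rpow (by fun_prop) (by fun_prop)
    intro x
    right
    exact abs_pos.2 (ne_of_gt x.1.2)
  exact this

theorem powC_nonneg (p : ℝ) (t : unitInterval) : 0 ≤ powC p t := Real.rpow_nonneg t.2.1 _

theorem norm_powC_le (p : ℝ) : ‖powC p‖ ≤ 1 := by
  rw [ContinuousMap.norm_le _ zero_le_one]
  intro t
  rw [Real.norm_of_nonneg (powC_nonneg p t)]
  exact Real.rpow_le_one t.2.1 t.2.2 (abs_nonneg p)

theorem powC_anti {p q : ℝ} (hp : 0 < p) (hpq : p ≤ q) (t : unitInterval) :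
    powC q t ≤ powC p t := by
  rw [powC_apply hp.le, powC_apply (hp.le.trans hpq)]
  rcases t.2.1.eq_or_lt with h | h
  · rw [← h, Real.zero_rpow hp.ne', Real.zero_rpow (hp.trans_le hpq).ne']
  · exact Real.rpow_le_rpow_of_exponent_ge h t.2.2 hpq

theorem powPsi_ofReal_toReal {p : ℝ} (hp : 0 < p) (t : unitInterval) :
    (powPsi (ENNReal.ofReal p) (Real.toNNReal (t : ℝ))).toReal = (p⁻¹ • powC p) t := by
  simp only [powPsi, powPhi, ENNReal.ofReal_ne_top, if_false, ContinuousMap.smul_apply,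
    powC_apply hp.le, ENNReal.toReal_ofReal hp.le, ENNReal.toReal_div, smul_eq_mul]
  rw [← ENNReal.toReal_rpow, ENNReal.coe_toReal, Real.coe_toNNReal _ t.2.1, div_eq_inv_mul]

theorem smul_powC_mem_classK {p : ℝ} (hp : 0 < p) {R : Set ℝ≥0∞} (hR : ENNReal.ofReal p ∈ R) :
    p⁻¹ • powC p ∈ classK R :=
  subset_closedConvexHull ⟨_, hR, by simpa using hp, fun t => (powPsi_ofReal_toReal hp t).symm⟩

theorem classK_mono {R R' : Set ℝ≥0∞} (h : R ⊆ R') : classK R ⊆ classK R' := by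
  apply (closedConvexHull ℝ).monotone
  rintro φ ⟨p, hp, h1⟩
  exact ⟨p, h hp, h1⟩

theorem isCompact_closedConvexHull {E : Type*} [NormedAddCommGroup E] [NormedSpace ℝ E]
    [CompleteSpace E] {s : Set E} (hs : IsCompact s) : IsCompact (closedConvexHull ℝ s) := by
  rw [closedConvexHull_eq_closure_convexHull]
  exact isCompact_iff_totallyBounded_isComplete.2
    ⟨(totallyBounded_convexHull.2 hs.totallyBounded).closure, isClosed_closure.isComplete⟩

/-- The normalized powers depend continuously on an exponent in `[a,b]`, so they form a compact set,
whose closed convex hull is compact by Mazur's theorem. -/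
theorem isCompact_classK {a b : ℝ} (ha : 0 < a) {R : Set ℝ≥0∞}
    (hR : R ⊆ Icc (ENNReal.ofReal a) (ENNReal.ofReal b)) : IsCompact (classK R) := by
  have hc : IsCompact ((fun p : ℝ => p⁻¹ • powC p) '' Icc a b) := by
    apply isCompact_Icc.image_of_continuousOn
    refine ContinuousOn.fun_smul ?_ ?_
    · exact continuousOn_id.inv₀ fun x hx => (ha.trans_le hx.1).ne'
    · exact continuousOn_powC.mono fun x hx => ha.trans_le hx.1
  refine (isCompact_closedConvexHull hc).of_isClosed_subset isClosed_closedConvexHull ?_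
  apply (closedConvexHull ℝ).monotone
  rintro φ ⟨p, hp, hp0, h⟩
  have hp1 := hR hp
  have hfin : p ≠ ∞ := ne_top_of_le_ne_top ENNReal.ofReal_ne_top hp1.2
  have hpa : a ≤ p.toReal := (ENNReal.ofReal_le_iff_le_toReal hfin).1 hp1.1
  have hpb : p.toReal ≤ b := by
    have hb : 0 < b := by
      by_contra hb
      have := hp1.2
      rw [ENNReal.ofReal_of_nonpos (not_lt.1 hb)] at this
      exact hp0.ne' (le_antisymm this zero_le)
    exact ENNReal.toReal_le_of_le_ofReal hb.le hp1.2
  refine ⟨p.toReal, ⟨hpa, hpb⟩, ?_⟩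
  ext t
  rw [h t, ← powPsi_ofReal_toReal (ha.trans_le hpa), ENNReal.ofReal_toReal hfin]

/-- Because `t^q = q Ψ_q(t)`, the weight of `Ψ_{q_k}` is `w_k q_k`; this is why the normalizing
factor is `∑ w_k q_k` and not `∑ w_k`. -/
theorem cone_mem_classK {ι : Type*} (s : Finset ι) (w q : ι → ℝ) (hw : ∀ k ∈ s, 0 ≤ w k)
    (hq : ∀ k ∈ s, 0 < q k) {R : Set ℝ≥0∞} (hR : ∀ k ∈ s, ENNReal.ofReal (q k) ∈ R)
    (hpos : 0 < ∑ k ∈ s, w k * q k) :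
    (∑ k ∈ s, w k * q k)⁻¹ • ∑ k ∈ s, w k • powC (q k) ∈ classK R := by
  have := (convex_closedConvexHull (𝕜 := ℝ) (s := {φ : C(unitInterval, ℝ) | ∃ p ∈ R, 0 < p ∧
    ∀ t : unitInterval, φ t = (powPsi p (Real.toNNReal (t : ℝ))).toReal})).sum_mem
    (t := s) (w := fun k => (∑ k ∈ s, w k * q k)⁻¹ * (w k * q k))
    (z := fun k => (q k)⁻¹ • powC (q k)) ?_ ?_ ?_
  · change _ ∈ closedConvexHull ℝ _
    convert this using 1
    rw [Finset.smul_sum]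
    refine Finset.sum_congr rfl fun k hk => ?_
    rw [smul_smul, smul_smul, mul_assoc, mul_assoc, mul_inv_cancel₀ (hq k hk).ne', mul_one]
  · intro k hk
    have := hw k hk
    have := hq k hk
    positivity
  · rw [← Finset.mul_sum, inv_mul_cancel₀ hpos.ne']
  · intro k hk
    exact smul_powC_mem_classK (hq k hk) (hR k hk)

theorem exists_tendsto_ultrafilter {ι X : Type*} [TopologicalSpace X] {K : Set X}
    (hK : IsCompact K) (U : Ultrafilter ι) {u : ι → X} (hu : ∀ᶠ n in U, u n ∈ K) :
    ∃ x ∈ K, Tendsto u U (𝓝 x) := by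
  obtain ⟨x, hx, h⟩ := hK.ultrafilter_le_nhds (U.map u) (by
    rw [le_principal_iff]; exact hu)
  exact ⟨x, hx, h⟩

end BourginNakano

/-! ### Limits of positive combinations of powers and their lowest exponent. -/

namespace BourginNakano

/-- The mass which the weights `w` on `s` give to the exponents `p k ≤ x`. -/
noncomputable def massBelow (p : ℕ → ℝ) (s : Finset ℕ) (w : ℕ → ℝ) (x : ℝ) : ℝ :=
  ∑ k ∈ s, if p k ≤ x then w k else 0

/-- The part of `∑ wₖ t ^ pₖ` with `pₖ ≤ x`, with the exponents below `r` raised to `r`. -/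
noncomputable def truncPow (p : ℕ → ℝ) (s : Finset ℕ) (w : ℕ → ℝ) (r x : ℝ) :
    C(unitInterval, ℝ) :=
  ∑ k ∈ s with p k ≤ x, w k • powC (max (p k) r)

section Finite

variable {p : ℕ → ℝ} {s : Finset ℕ} {w : ℕ → ℝ}

theorem massBelow_mono (hw : ∀ k, 0 ≤ w k) {x y : ℝ} (h : x ≤ y) :
    massBelow p s w x ≤ massBelow p s w y := by
  refine Finset.sum_le_sum fun k _ => ?_
  split_ifs with h1 h2
  · exact le_rfl
  · exact absurd (h1.trans h) h2
  · exact hw k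
  · exact le_rfl

theorem massBelow_nonneg (hw : ∀ k, 0 ≤ w k) (x : ℝ) : 0 ≤ massBelow p s w x :=
  Finset.sum_nonneg fun k _ => by split_ifs; exacts [hw k, le_rfl]

theorem massBelow_le (hw : ∀ k, 0 ≤ w k) (x : ℝ) : massBelow p s w x ≤ ∑ k ∈ s, w k :=
  Finset.sum_le_sum fun k _ => by split_ifs; exacts [le_rfl, hw k]

theorem truncPow_apply (r x : ℝ) (t : unitInterval) :
    truncPow p s w r x t = ∑ k ∈ s, if p k ≤ x then w k * powC (max (p k) r) t else 0 := by
  rw [truncPow, ContinuousMap.sum_apply, Finset.sum_filter]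
  rfl

theorem massBelow_mul_le_truncPow (hp : ∀ k, 0 < p k) (hw : ∀ k, 0 ≤ w k) {r x : ℝ} (hrx : r ≤ x)
    (t : unitInterval) : massBelow p s w x * powC x t ≤ truncPow p s w r x t := by
  rw [truncPow_apply, massBelow, Finset.sum_mul]
  refine Finset.sum_le_sum fun k _ => ?_
  split_ifs with h
  · exact mul_le_mul_of_nonneg_left
      (powC_anti ((hp k).trans_le (le_max_left _ _)) (max_le h hrx) t) (hw k)
  · simp

theorem truncPow_le (hp : ∀ k, 0 < p k) (hw : ∀ k, 0 ≤ w k) (r x : ℝ) (t : unitInterval) :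
    truncPow p s w r x t ≤ (∑ k ∈ s, w k • powC (p k)) t := by
  rw [truncPow_apply, ContinuousMap.sum_apply]
  refine Finset.sum_le_sum fun k _ => ?_
  split_ifs with h
  · exact mul_le_mul_of_nonneg_left (powC_anti (hp k) (le_max_left _ _) t) (hw k)
  · exact mul_nonneg (hw k) (powC_nonneg _ _)

/-- Each exponent is charged to one error: up to `r'` to its mass, between `r'` and `r` to the cost
of raising it to `r`, beyond `x` to `t^x`. The rest is the truncation. -/
theorem sum_powC_le (hw : ∀ k, 0 ≤ w k) {M r' r x : ℝ}
    (hM : ∑ k ∈ s, w k ≤ M) (h0 : 0 < r') (h1 : r' < r) (h2 : r ≤ x) (t : unitInterval) :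
    (∑ k ∈ s, w k • powC (p k)) t ≤ truncPow p s w r x t + massBelow p s w r' +
      M * (powC r' t - powC r t) + M * powC x t := by
  have hd : 0 ≤ powC r' t - powC r t := sub_nonneg.2 (powC_anti h0 h1.le t)
  have h3 : (∑ k ∈ s, w k) * (powC r' t - powC r t) + (∑ k ∈ s, w k) * powC x t ≤
      M * (powC r' t - powC r t) + M * powC x t :=
    add_le_add (mul_le_mul_of_nonneg_right hM hd)
      (mul_le_mul_of_nonneg_right hM (powC_nonneg _ _))
  refine le_trans ?_ (le_trans (add_le_add_right h3 (truncPow p s w r x t + massBelow p s w r'))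
    (by linarith))
  rw [truncPow_apply, massBelow, ContinuousMap.sum_apply, Finset.sum_mul, Finset.sum_mul,
    ← Finset.sum_add_distrib, ← Finset.sum_add_distrib, ← Finset.sum_add_distrib]
  refine Finset.sum_le_sum fun k _ => ?_
  have hwd : 0 ≤ w k * (powC r' t - powC r t) := mul_nonneg (hw k) hd
  have hwx : 0 ≤ w k * powC x t := mul_nonneg (hw k) (powC_nonneg _ _)
  change w k * powC (p k) t ≤ _
  have hle1 : powC (p k) t ≤ 1 :=
    (le_abs_self _).trans (((powC (p k)).norm_coe_le_norm t).trans (norm_powC_le _))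
  by_cases hx : p k ≤ x
  · rw [if_pos hx]
    have hmax : 0 ≤ w k * powC (max (p k) r) t := mul_nonneg (hw k) (powC_nonneg _ _)
    by_cases hr' : p k ≤ r'
    · rw [if_pos hr']
      have := mul_le_mul_of_nonneg_left hle1 (hw k)
      linarith
    · rw [if_neg hr']
      rcases le_total r (p k) with hr | hr
      · rw [max_eq_left hr]
        linarith
      · rw [max_eq_right hr]
        have := mul_le_mul_of_nonneg_left (powC_anti h0 (not_le.1 hr').le t) (hw k)
        linarith
  · rw [if_neg hx, if_neg (fun h => hx (h.trans (h1.le.trans h2)))]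
    have := mul_le_mul_of_nonneg_left (powC_anti (h0.trans (h1.trans_le h2)) (not_le.1 hx).le t)
      (hw k)
    linarith

/-- The two-sided bound on `c` lets both factors be passed to the limit with `c` staying away from
zero. -/
theorem exists_smul_classK_eq_truncPow {r x : ℝ} (hr : 0 < r) (hrx : r ≤ x)
    (hw : ∀ k, 0 ≤ w k) {R : Set ℝ≥0∞} (hR : ∀ k, p k ≤ x → ENNReal.ofReal (max (p k) r) ∈ R)
    (hpos : 0 < massBelow p s w x) :
    ∃ c, ∃ κ ∈ classK R, r * massBelow p s w x ≤ c ∧ c ≤ x * massBelow p s w x ∧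
      truncPow p s w r x = c • κ := by
  have hmass : massBelow p s w x = ∑ k ∈ s with p k ≤ x, w k := by
    rw [massBelow, Finset.sum_filter]
  have h1 : r * massBelow p s w x ≤ ∑ k ∈ s with p k ≤ x, w k * max (p k) r := by
    rw [hmass, Finset.mul_sum]
    refine Finset.sum_le_sum fun k _ => ?_
    rw [mul_comm]
    exact mul_le_mul_of_nonneg_left (le_max_right _ _) (hw k)
  have hc := (mul_pos hr hpos).trans_le h1
  refine ⟨_, _, cone_mem_classK {k ∈ s | p k ≤ x} w (fun k => max (p k) r) (fun k _ => hw k)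
    (fun k _ => hr.trans_le (le_max_right _ _)) (fun k hk => hR k (Finset.mem_filter.1 hk).2) hc,
    h1, ?_, ?_⟩
  · rw [hmass, Finset.mul_sum]
    refine Finset.sum_le_sum fun k hk => ?_
    rw [mul_comm]
    exact mul_le_mul_of_nonneg_right (max_le (Finset.mem_filter.1 hk).2 hrx) (hw k)
  · rw [smul_smul, mul_inv_cancel₀ hc.ne', one_smul, truncPow]

end Finite

theorem exists_limit_of_weights {p : ℕ → ℝ} {pm pM : ℝ} (hpm : 0 < pm) (hp1 : ∀ k, pm ≤ p k)
    (hp2 : ∀ k, p k ≤ pM) (s : ℕ → Finset ℕ) (w : ℕ → ℕ → ℝ) (hw : ∀ n k, 0 ≤ w n k) {m M : ℝ}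
    (hm : 0 < m) (hm1 : ∀ n, m ≤ ∑ k ∈ s n, w n k) (hM : ∀ n, ∑ k ∈ s n, w n k ≤ M)
    (hs : ∀ N, ∀ᶠ n in atTop, ∀ k ∈ s n, N ≤ k) :
    ∃ F : C(unitInterval, ℝ),
      (∀ ε > 0, ∃ᶠ n in atTop, ‖∑ k ∈ s n, w n k • powC (p k) - F‖ < ε) ∧
      (∀ t, 0 ≤ F t) ∧ Monotone F ∧ (∀ l t, F (l * t) ≤ (l : ℝ) ^ pm * F t) ∧
      ∃ r, 0 < r ∧ MapClusterPt r atTop p ∧ ∀ x > r,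
        ∃ κ ∈ classK (closure (range fun k => ENNReal.ofReal (p k)) ∩
          Icc (ENNReal.ofReal r) (ENNReal.ofReal x)),
        ∃ a b : ℝ, 0 < a ∧ 0 < b ∧ ∀ t, a * κ t ≤ F t ∧ F t ≤ b * κ t := by
  -- One nonprincipal ultrafilter makes the masses converge for all real `x` at once, together with
  -- the functions, so that no diagonal extraction is needed.
  set U : Ultrafilter ℕ := hyperfilter ℕ
  have hU : (U : Filter ℕ) ≤ atTop := Nat.hyperfilter_le_atTop
  have hp0 : ∀ k, 0 < p k := fun k => hpm.trans_le (hp1 k)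
  set f : ℕ → C(unitInterval, ℝ) := fun n => ∑ k ∈ s n, w n k • powC (p k) with hf
  have hmM : ∀ x n, massBelow p (s n) (w n) x ∈ Icc 0 M := fun x n =>
    ⟨massBelow_nonneg (hw n) x, (massBelow_le (hw n) x).trans (hM n)⟩
  have hM0 : 0 < M := hm.trans_le ((hm1 0).trans (hM 0))
  choose mu hmu0 hmu using fun x => exists_tendsto_ultrafilter isCompact_Icc U
    (Eventually.of_forall (hmM x))
  have mu_mono : Monotone mu := fun x y hxy =>
    le_of_tendsto_of_tendsto (hmu x) (hmu y)
      (Eventually.of_forall fun n => massBelow_mono (hw n) hxy)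
  have mu_top : 0 < mu pM := by
    refine hm.trans_le (ge_of_tendsto (hmu pM) (Eventually.of_forall fun n => ?_))
    simpa [massBelow, hp2] using hm1 n
  have mu_bot : ∀ x < pm, mu x = 0 := fun x hx => by
    refine tendsto_nhds_unique (hmu x) (tendsto_const_nhds.congr fun n => ?_)
    rw [massBelow, Finset.sum_eq_zero]
    intro k _
    rw [if_neg (not_le.2 (hx.trans_le (hp1 k)))]
  set r := sInf {x | 0 < mu x} with hr
  have hbdd : pm ∈ lowerBounds {x | 0 < mu x} := fun x hx => by
    by_contra h
    exact (hx : 0 < mu x).ne' (mu_bot x (not_le.1 h))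
  have hrm : pm ≤ r := le_csInf ⟨pM, mu_top⟩ hbdd
  have hr0 : 0 < r := hpm.trans_le hrm
  have mu_pos : ∀ x > r, 0 < mu x := fun x hx => by
    obtain ⟨y, hy, hyx⟩ := exists_lt_of_csInf_lt ⟨pM, mu_top⟩ hx
    exact (hy : 0 < mu y).trans_le (mu_mono hyx.le)
  have mu_zero : ∀ x < r, mu x = 0 := fun x hx =>
    le_antisymm (not_lt.1 fun h => notMem_of_lt_csInf hx ⟨pm, hbdd⟩ h) (hmu0 x).1
  have hclus : MapClusterPt r atTop p := by
    rw [mapClusterPt_iff_frequently]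
    intro V hV
    obtain ⟨ε, hε, hVε⟩ := Metric.mem_nhds_iff.1 hV
    rw [frequently_atTop]
    intro N
    -- The limiting mass jumps from zero to a positive value across `r`, so some index in a far
    -- block has its exponent within `ε / 2` of `r`.
    have h1 : ∀ᶠ n in U, massBelow p (s n) (w n) (r - ε / 2) <
        massBelow p (s n) (w n) (r + ε / 2) := by
      refine (hmu _).eventually_lt (hmu _) ?_
      rw [mu_zero _ (by linarith)]
      exact mu_pos _ (by linarith)
    obtain ⟨n, hn, hn'⟩ := (h1.and (hU (hs N))).exists
    obtain ⟨k, hk, hlt⟩ := Finset.exists_lt_of_sum_lt hn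
    refine ⟨k, hn' k hk, hVε ?_⟩
    rw [Real.ball_eq_Ioo]
    split_ifs at hlt with h2 h3 h3
    · exact absurd hlt (lt_irrefl _)
    · exact absurd hlt (not_lt.2 (hw n k))
    · constructor <;> linarith
    · exact absurd hlt (lt_irrefl _)
  have hrR : ENNReal.ofReal r ∈ closure (range fun k => ENNReal.ofReal (p k)) := by
    have h1 : MapClusterPt (ENNReal.ofReal r) atTop (fun k => ENNReal.ofReal (p k)) :=
      hclus.continuousAt_comp ENNReal.continuous_ofReal.continuousAt
    rw [mem_closure_iff_nhds]
    intro V hV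
    obtain ⟨k, hk⟩ := (mapClusterPt_iff_frequently.1 h1 V hV).exists
    exact ⟨_, hk, k, rfl⟩
  have hlim : ∀ x ≥ r, 0 < mu x → ∃ c : ℝ, 0 < c ∧ ∃ κ ∈ classK
      (closure (range fun k => ENNReal.ofReal (p k)) ∩
          Icc (ENNReal.ofReal r) (ENNReal.ofReal x)),
      Tendsto (fun n => truncPow p (s n) (w n) r x) U (𝓝 (c • κ)) := by
    intro x hx hmux
    set R := closure (range fun k => ENNReal.ofReal (p k)) ∩
          Icc (ENNReal.ofReal r) (ENNReal.ofReal x)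
    have hRmem : ∀ k, p k ≤ x → ENNReal.ofReal (max (p k) r) ∈ R := fun k hk => by
      refine ⟨?_, ENNReal.ofReal_le_ofReal (le_max_right _ _),
        ENNReal.ofReal_le_ofReal (max_le hk hx)⟩
      rcases le_total r (p k) with h | h
      · rw [max_eq_left h]
        exact subset_closure ⟨k, rfl⟩
      · rwa [max_eq_right h]
    have hev : ∀ᶠ n in U, mu x / 2 < massBelow p (s n) (w n) x :=
      (hmu x).eventually_const_lt (by linarith)
    have : ∀ n, ∃ (c : ℝ) (κ : C(unitInterval, ℝ)), mu x / 2 < massBelow p (s n) (w n) x →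
        c ∈ Icc (r * (mu x / 2)) (x * M) ∧ κ ∈ classK R ∧
          truncPow p (s n) (w n) r x = c • κ := by
      intro n
      by_cases h : mu x / 2 < massBelow p (s n) (w n) x
      · obtain ⟨c, κ, h1, h2, h3, h4⟩ := exists_smul_classK_eq_truncPow (p := p) (s := s n)
          hr0 hx (hw n) hRmem ((half_pos hmux).trans h)
        refine ⟨c, κ, fun _ => ⟨⟨le_trans ?_ h2, h3.trans ?_⟩, h1, h4⟩⟩
        · exact mul_le_mul_of_nonneg_left h.le hr0.le
        · exact mul_le_mul_of_nonneg_left (hmM x n).2 (hr0.le.trans hx)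
      -- Dummy values: the mass exceeds `mu x / 2` for `U`-almost every `n`, so this case does not
      -- affect the limit.
      · exact ⟨0, 0, fun h' => absurd h' h⟩
    choose c κ hcκ using this
    obtain ⟨c0, hc0, hct⟩ := exists_tendsto_ultrafilter isCompact_Icc U
      (hev.mono fun n hn => (hcκ n hn).1)
    obtain ⟨κ0, hκ0, hκt⟩ := exists_tendsto_ultrafilter
      (isCompact_classK (R := R) hr0 inter_subset_right) U
      (hev.mono fun n hn => (hcκ n hn).2.1)
    refine ⟨c0, (mul_pos hr0 (half_pos hmux)).trans_le hc0.1, κ0, hκ0, ?_⟩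
    exact (hct.smul hκt).congr' (hev.mono fun n hn => (hcκ n hn).2.2.symm)
  have heval : ∀ {u : ℕ → C(unitInterval, ℝ)} {g : C(unitInterval, ℝ)}, Tendsto u U (𝓝 g) →
      ∀ t, Tendsto (fun n => u n t) U (𝓝 (g t)) := fun h t =>
    ((ContinuousEvalConst.continuous_eval_const t).tendsto _).comp h
  obtain ⟨F, hF⟩ : ∃ F, Tendsto f U (𝓝 F) := by
    have hrM : r ≤ pM := not_lt.1 fun h => mu_top.ne' (mu_zero _ h)
    -- Compact home of all the `f n`: an element of `K([pm, pM])` times `∑ w_k p_k`, which is at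
    -- most `pM * M`.
    have hc : IsCompact ((fun q : ℝ × C(unitInterval, ℝ) => q.1 • q.2) ''
        (Icc 0 (pM * M) ×ˢ classK (Icc (ENNReal.ofReal pm) (ENNReal.ofReal pM)))) :=
      (isCompact_Icc.prod (isCompact_classK hpm subset_rfl)).image (by fun_prop)
    obtain ⟨F, -, hF⟩ := exists_tendsto_ultrafilter hc U (u := f) (Eventually.of_forall fun n => by
      have h1 : 0 < ∑ k ∈ s n, w n k * p k := by
        refine (mul_pos hpm (hm.trans_le (hm1 n))).trans_le ?_
        rw [Finset.mul_sum]
        exact Finset.sum_le_sum fun k _ => by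
          rw [mul_comm]; exact mul_le_mul_of_nonneg_left (hp1 k) (hw n k)
      refine ⟨⟨_, _⟩, ⟨⟨h1.le, ?_⟩, cone_mem_classK (s n) (w n) p (fun k _ => hw n k)
        (fun k _ => hp0 k) (fun k _ => ⟨ENNReal.ofReal_le_ofReal (hp1 k),
          ENNReal.ofReal_le_ofReal (hp2 k)⟩) h1⟩, ?_⟩
      · refine le_trans ?_ (mul_le_mul_of_nonneg_left (hM n) (hr0.le.trans hrM))
        rw [Finset.mul_sum]
        exact Finset.sum_le_sum fun k _ => by
          rw [mul_comm]; exact mul_le_mul_of_nonneg_right (hp2 k) (hw n k)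
      · change _ • _ • _ = f n
        rw [smul_smul]
        exact (congrArg (· • f n) (mul_inv_cancel₀ h1.ne')).trans (one_smul _ _))
    exact ⟨F, hF⟩
  have hfapp : ∀ n t, f n t = ∑ k ∈ s n, w n k * powC (p k) t := fun n t => by
    simp [hf, ContinuousMap.sum_apply]
  refine ⟨F, fun ε hε => ?_, fun t => ?_, fun t t' htt => ?_, fun l t => ?_, r, hr0, hclus,
    fun x hx => ?_⟩
  · have h1 : ∀ᶠ n in U, ‖f n - F‖ < ε := by
      simpa [dist_eq_norm] using (Metric.tendsto_nhds.1 hF ε hε)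
    exact h1.frequently.filter_mono hU
  · refine ge_of_tendsto (heval hF t) (Eventually.of_forall fun n => ?_)
    rw [hfapp]
    exact Finset.sum_nonneg fun k _ => mul_nonneg (hw n k) (powC_nonneg _ _)
  · refine le_of_tendsto_of_tendsto (heval hF t) (heval hF t') (Eventually.of_forall fun n => ?_)
    simp only [hfapp]
    refine Finset.sum_le_sum fun k _ => mul_le_mul_of_nonneg_left ?_ (hw n k)
    exact Real.rpow_le_rpow t.2.1 htt (abs_nonneg _)
  · refine le_of_tendsto_of_tendsto (heval hF (l * t)) ((heval hF t).const_mul _)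
      (Eventually.of_forall fun n => ?_)
    simp only [hfapp]
    rw [Finset.mul_sum]
    refine Finset.sum_le_sum fun k _ => ?_
    rw [mul_left_comm]
    refine mul_le_mul_of_nonneg_left ?_ (hw n k)
    rw [powC_apply (hp0 k).le, powC_apply (hp0 k).le]
    change ((l : ℝ) * t) ^ p k ≤ _
    rw [Real.mul_rpow l.2.1 t.2.1]
    refine mul_le_mul_of_nonneg_right ?_ (Real.rpow_nonneg t.2.1 _)
    rw [← powC_apply (hp0 k).le, ← powC_apply hpm.le]
    exact powC_anti hpm (hp1 k) l
  · obtain ⟨c, hc, κ, hκ, hG⟩ := hlim x hx.le (mu_pos x hx)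
    refine ⟨κ, hκ, c, (1 + M / mu x) * c, hc, mul_pos (add_pos one_pos (div_pos hM0 (mu_pos x hx)))
      hc, fun t => ⟨?_, ?_⟩⟩
    · exact le_of_tendsto_of_tendsto (heval hG t) (heval hF t)
        (Eventually.of_forall fun n => truncPow_le hp0 (hw n) r x t)
    -- Multiplying by `mu x` lets the tail `M t^x` be absorbed, since mass times `t^x` is at most
    -- the truncation. The mass below `r'` tends to zero; letting `r'` increase to `r` then removes
    -- the cost of raising exponents.
    · have h1 : ∀ r', 0 < r' → r' < r → mu x * F t ≤
          mu x * (c * κ t + 0 + M * (powC r' t - powC r t)) + M * (c * κ t) := by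
        intro r' h0 hr'
        refine le_of_tendsto_of_tendsto ((hmu x).mul (heval hF t))
          (((hmu x).mul (((heval hG t).add (mu_zero r' hr' ▸ hmu r')).add_const _)).add
            ((heval hG t).const_mul M)) (Eventually.of_forall fun n => ?_)
        have h2 := sum_powC_le (p := p) (s := s n) (hw n) (hM n) h0 hr' hx.le t
        have h3 := massBelow_mul_le_truncPow (s := s n) hp0 (hw n) hx.le t
        have h4 := mul_le_mul_of_nonneg_left h2 (hmM x n).1
        have h5 := mul_le_mul_of_nonneg_left h3 hM0.le
        change _ * (∑ k ∈ s n, w n k • powC (p k)) t ≤ _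
        nlinarith
      have h2 : mu x * F t ≤ mu x * (c * κ t + 0 + M * (powC r t - powC r t)) + M * (c * κ t) := by
        have hcont : Tendsto (fun r' => powC r' t) (𝓝[<] r) (𝓝 (powC r t)) := by
          have := (continuousOn_powC.continuousAt (Ioi_mem_nhds hr0)).tendsto
          exact (((ContinuousEvalConst.continuous_eval_const t).tendsto _).comp this).mono_left
            nhdsWithin_le_nhds
        refine ge_of_tendsto ((((hcont.sub_const _).const_mul M).const_add _).const_mul (mu x)
          |>.add_const (M * (c * κ t))) ?_
        filter_upwards [self_mem_nhdsWithin, nhdsWithin_le_nhds (Ioi_mem_nhds hr0)] with r' h h'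
        exact h1 r' h' h
      have h3 := mu_pos x hx
      have h4 : F t ≤ (mu x * (c * κ t) + M * (c * κ t)) / mu x := by
        rw [le_div_iff₀ h3]; linarith
      refine h4.trans (le_of_eq ?_)
      field_simp

end BourginNakano

/-! ### The modular for real exponents, and the gliding hump. -/

namespace BourginNakano

/-- The modular `∑ₖ aₖ ^ pₖ` of a non-negative sequence for a real-valued exponent. -/
noncomputable def powModular (p : ℕ → ℝ) (a : ℕ → ℝ≥0) : ℝ≥0∞ := ∑' k, (a k : ℝ≥0∞) ^ p k

section Modular

variable {p : ℕ → ℝ} {pm pM : ℝ}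

theorem modular_varExp {P : ℕ → ℝ≥0∞} (hP : ∀ k, P k ≠ ∞) (a : ℕ → ℝ≥0) :
    modular (varExp P) a = powModular (fun k => (P k).toReal) a := by
  simp [modular, varExp, powPhi, powModular, hP]

theorem powModular_mono (hp : ∀ k, 0 < p k) {a b : ℕ → ℝ≥0} (h : ∀ k, a k ≤ b k) :
    powModular p a ≤ powModular p b :=
  ENNReal.tsum_le_tsum fun k => ENNReal.rpow_le_rpow (by exact_mod_cast h k) (hp k).le

theorem powModular_mul_le_of_le_one (hpm : 0 < pm) (hp1 : ∀ k, pm ≤ p k) {l : ℝ≥0} (hl : l ≤ 1)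
    (a : ℕ → ℝ≥0) : powModular p (fun k => l * a k) ≤ (l : ℝ≥0∞) ^ pm * powModular p a := by
  rw [powModular, powModular, ← ENNReal.tsum_mul_left]
  refine ENNReal.tsum_le_tsum fun k => ?_
  rw [ENNReal.coe_mul, ENNReal.mul_rpow_of_nonneg _ _ (hpm.le.trans (hp1 k))]
  gcongr ?_ * _
  exact ENNReal.rpow_le_rpow_of_exponent_ge (by exact_mod_cast hl) (hp1 k)

theorem powModular_mul_le_of_one_le (hp : ∀ k, 0 < p k) (hp2 : ∀ k, p k ≤ pM) {l : ℝ≥0}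
    (hl : 1 ≤ l) (a : ℕ → ℝ≥0) :
    powModular p (fun k => l * a k) ≤ (l : ℝ≥0∞) ^ pM * powModular p a := by
  rw [powModular, powModular, ← ENNReal.tsum_mul_left]
  refine ENNReal.tsum_le_tsum fun k => ?_
  rw [ENNReal.coe_mul, ENNReal.mul_rpow_of_nonneg _ _ (hp k).le]
  gcongr ?_ * _
  exact ENNReal.rpow_le_rpow_of_exponent_le (by exact_mod_cast hl) (hp2 k)

theorem powModular_add_le (hp : ∀ k, 0 < p k) (hp2 : ∀ k, p k ≤ pM) (a b : ℕ → ℝ≥0) :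
    powModular p (fun k => a k + b k) ≤ 2 ^ pM * (powModular p a + powModular p b) := by
  rw [powModular, powModular, powModular, ← ENNReal.tsum_add, ← ENNReal.tsum_mul_left]
  refine ENNReal.tsum_le_tsum fun k => ?_
  have h1 : ((a k + b k : ℝ≥0) : ℝ≥0∞) ≤ 2 * max (a k : ℝ≥0∞) (b k) := by
    rw [ENNReal.coe_add, two_mul]
    exact add_le_add (le_max_left _ _) (le_max_right _ _)
  refine (ENNReal.rpow_le_rpow h1 (hp k).le).trans ?_
  rw [ENNReal.mul_rpow_of_nonneg _ _ (hp k).le]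
  refine mul_le_mul' (ENNReal.rpow_le_rpow_of_exponent_le (by norm_num) (hp2 k)) ?_
  rcases le_total (a k : ℝ≥0∞) (b k) with h | h
  · rw [max_eq_right h]; exact le_add_self
  · rw [max_eq_left h]; exact le_self_add

/-- Stated for an abstract `ρ` because it serves the variable-exponent modular, the modular of `F`
and a plain power. -/
theorem exists_mul_lt_of_scaling {ρ : (ℕ → ℝ≥0) → ℝ≥0∞} {q : ℝ} (hq : 0 < q) {a : ℕ → ℝ≥0}
    (hρ : ∀ l : ℝ≥0, l ≤ 1 → ρ (fun k => l * a k) ≤ (l : ℝ≥0∞) ^ q * ρ a)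
    (ha : ρ a ≠ ∞) {ε : ℝ≥0∞} (hε : 0 < ε) : ∃ l : ℝ≥0, 0 < l ∧ l ≤ 1 ∧
      ρ (fun k => l * a k) < ε := by
  have h : Tendsto (fun l : ℝ≥0 => (l : ℝ≥0∞) ^ q * ρ a) (𝓝[>] 0) (𝓝 0) := by
    have h1 : Tendsto (fun l : ℝ≥0 => (l : ℝ≥0∞) ^ q * ρ a) (𝓝 0)
        (𝓝 (((0 : ℝ≥0) : ℝ≥0∞) ^ q * ρ a)) := by
      refine ENNReal.Tendsto.mul_const ?_ (Or.inr ha)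
      exact ((ENNReal.continuous_rpow_const (y := q)).comp ENNReal.continuous_coe).tendsto 0
    rw [ENNReal.coe_zero, ENNReal.zero_rpow_of_pos hq, zero_mul] at h1
    exact h1.mono_left nhdsWithin_le_nhds
  have h2 : ∀ᶠ l : ℝ≥0 in 𝓝[>] 0, l ≤ 1 :=
    nhdsWithin_le_nhds (Iic_mem_nhds one_pos)
  obtain ⟨l, ⟨h3, h4⟩, h5⟩ := ((h.eventually_lt_const hε).and h2).and self_mem_nhdsWithin |>.exists
  exact ⟨l, h5, h4, (hρ l h4).trans_lt h3⟩

variable {𝕜 : Type*} [RCLike 𝕜]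

/-- Iterating the quasi-triangle inequality costs one factor `2 ^ pM` per step, so the `j`-th term
must be geometrically small; this dictates the errors allowed in the gliding hump. -/
theorem powModular_sum_le (hp : ∀ k, 0 < p k) (hp2 : ∀ k, p k ≤ pM) (J : ℕ) (u : ℕ → ℕ → 𝕜) :
    powModular p (fun k => ‖∑ j ∈ Finset.range J, u j k‖₊) ≤
      ∑ j ∈ Finset.range J, (2 ^ pM) ^ (j + 1) * powModular p (fun k => ‖u j k‖₊) := by
  induction J generalizing u with
  | zero => simp [powModular, hp]
  | succ J ih =>
    have h1 := ih (fun j => u (j + 1))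
    rw [Finset.sum_range_succ']
    simp_rw [Finset.sum_range_succ']
    refine (powModular_mono hp (fun k => nnnorm_add_le _ _)).trans
      ((powModular_add_le hp hp2 _ _).trans ?_)
    rw [mul_add, zero_add, pow_one]
    gcongr ?_ + _
    refine (mul_le_mul_right h1 _).trans (le_of_eq ?_)
    rw [Finset.mul_sum]
    refine Finset.sum_congr rfl fun j _ => ?_
    rw [pow_succ' _ (j + 1), mul_assoc]

theorem powModular_sum_disjoint (hp : ∀ k, 0 < p k) (J : ℕ) (z : ℕ → ℕ → 𝕜)
    (hz : ∀ i j, i ≠ j → ∀ k, z i k = 0 ∨ z j k = 0) :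
    powModular p (fun k => ‖∑ j ∈ Finset.range J, z j k‖₊) =
      ∑ j ∈ Finset.range J, powModular p (fun k => ‖z j k‖₊) := by
  unfold powModular
  rw [← Summable.tsum_finsetSum fun _ _ => ENNReal.summable]
  congr 1
  ext k
  beta_reduce
  by_cases h : ∃ j ∈ Finset.range J, z j k ≠ 0
  · obtain ⟨j, hj, hjk⟩ := h
    have h0 : ∀ i, i ≠ j → z i k = 0 := fun i hij => (hz i j hij k).resolve_right hjk
    rw [Finset.sum_eq_single_of_mem j hj fun i _ hij => h0 i hij,
      Finset.sum_eq_single_of_mem j hj fun i _ hij => by simp [h0 i hij, hp k]]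
  · push Not at h
    rw [Finset.sum_eq_zero h, Finset.sum_eq_zero fun j hj => by simp [h j hj, hp k]]
    simp [hp k]

theorem powModular_lt_one_of_luxemburg_lt_one {P : ℕ → ℝ≥0∞} (hP : ∀ k, P k ≠ ∞)
    (hpm : 0 < pm) (hp1 : ∀ k, pm ≤ (P k).toReal) {f : ℕ → 𝕜} (hf : f ∈ moSpace 𝕜 (varExp P))
    (h : luxemburg (varExp P) f < 1) :
    powModular (fun k => (P k).toReal) (fun k => ‖f k‖₊) < 1 := by
  -- The infimum of the empty set is `0` in `ℝ≥0`, so a small gauge says nothing until the set is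
  -- known to be nonempty.
  have hne : {t : ℝ≥0 | 0 < t ∧ modular (varExp P) (fun n => ‖f n‖₊ / t) < 1}.Nonempty := by
    obtain ⟨t, ht, hft⟩ := hf
    rw [modular_varExp hP] at hft
    obtain ⟨l, hl, hl1, h2⟩ := exists_mul_lt_of_scaling hpm
      (fun l hl => powModular_mul_le_of_le_one hpm hp1 hl (fun n => t * ‖f n‖₊)) hft.ne one_pos
    refine ⟨(l * t)⁻¹, inv_pos.2 (mul_pos hl ht), ?_⟩
    rw [modular_varExp hP]
    convert h2 using 3 with k
    rw [div_inv_eq_mul]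
    ring
  obtain ⟨t, ⟨ht0, ht⟩, ht1⟩ := exists_lt_of_csInf_lt hne h
  rw [modular_varExp hP] at ht
  refine lt_of_le_of_lt (powModular_mono (fun k => hpm.trans_le (hp1 k)) fun k => ?_) ht
  exact le_div_self zero_le ht0 ht1.le

theorem luxemburg_le_one_of_powModular_lt_one {P : ℕ → ℝ≥0∞} (hP : ∀ k, P k ≠ ∞) {f : ℕ → 𝕜}
    (h : powModular (fun k => (P k).toReal) (fun k => ‖f k‖₊) < 1) :
    luxemburg (varExp P) f ≤ 1 := by
  refine csInf_le (OrderBot.bddBelow _) ⟨one_pos, ?_⟩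
  rw [modular_varExp hP]
  simpa using h

/-- The restriction of a sequence to the block `[N, N')`. -/
def block (N N' : ℕ) (y : ℕ → 𝕜) (k : ℕ) : 𝕜 := if N ≤ k ∧ k < N' then y k else 0

theorem powModular_sub_block_le (hp : ∀ k, 0 < p k) {N N' : ℕ} (h : N ≤ N') (y : ℕ → 𝕜) :
    powModular p (fun k => ‖y k - block N N' y k‖₊) ≤
      ∑ k ∈ Finset.range N, (‖y k‖₊ : ℝ≥0∞) ^ p k +
        ∑' k, (‖y (k + N')‖₊ : ℝ≥0∞) ^ p (k + N') := by
  rw [powModular, ← Summable.sum_add_tsum_nat_add' (k := N') ENNReal.summable]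
  refine add_le_add ?_ (ENNReal.tsum_le_tsum fun k => ?_)
  · rw [← Finset.sum_subset (Finset.range_mono h)]
    · refine Finset.sum_le_sum fun k hk => ?_
      rw [block, if_neg fun hh => absurd hh.1 (not_le.2 (Finset.mem_range.1 hk)), sub_zero]
    · intro k hk hk'
      rw [block, if_pos ⟨not_lt.1 fun hh => hk' (Finset.mem_range.2 hh), Finset.mem_range.1 hk⟩]
      simp [hp k]
  · rw [block, if_neg fun hh => absurd hh.2 (by omega), sub_zero]

/-- Gliding hump: a late term is small on the coordinates already used, and its finite modular has a
small tail. -/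
theorem exists_block_approx (hp : ∀ k, 0 < p k) (y : ℕ → ℕ → 𝕜)
    (hy : ∀ k, Tendsto (fun n => y n k) atTop (𝓝 0))
    (hfin : ∀ n, powModular p (fun k => ‖y n k‖₊) ≠ ∞) (ε : ℕ → ℝ≥0∞) (hε : ∀ j, 0 < ε j) :
    ∃ n N : ℕ → ℕ, StrictMono n ∧ StrictMono N ∧ ∀ j,
      powModular p (fun k => ‖y (n j) k - block (N j) (N (j + 1)) (y (n j)) k‖₊) < ε j := by
  have step : ∀ (j : ℕ) (s : ℕ × ℕ), ∃ s' : ℕ × ℕ, s.1 < s'.1 ∧ s.2 < s'.2 ∧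
      powModular p (fun k => ‖y s'.1 k - block s.2 s'.2 (y s'.1) k‖₊) < ε j := by
    intro j s
    have h2 : 0 < ε j / 2 := ENNReal.half_pos (hε j).ne'
    have hhead : Tendsto (fun n => ∑ k ∈ Finset.range s.2, (‖y n k‖₊ : ℝ≥0∞) ^ p k) atTop
        (𝓝 0) := by
      rw [← Finset.sum_const_zero (s := Finset.range s.2)]
      refine tendsto_finsetSum _ fun k _ => ?_
      have h3 : Continuous fun x : 𝕜 => (‖x‖₊ : ℝ≥0∞) ^ p k :=
        ENNReal.continuous_rpow_const.comp (ENNReal.continuous_coe.comp continuous_nnnorm)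
      have := (h3.tendsto 0).comp (hy k)
      simpa [hp k, Function.comp_def] using this
    obtain ⟨n, hn, hns⟩ := ((hhead.eventually_lt_const h2).and (eventually_gt_atTop s.1)).exists
    have htail := ENNReal.tendsto_sum_nat_add (fun k => (‖y n k‖₊ : ℝ≥0∞) ^ p k) (hfin n)
    obtain ⟨N', hN', hNs⟩ := ((htail.eventually_lt_const h2).and (eventually_gt_atTop s.2)).exists
    refine ⟨(n, N'), hns, hNs, (powModular_sub_block_le hp hNs.le _).trans_lt ?_⟩
    calc _ < ε j / 2 + ε j / 2 := ENNReal.add_lt_add hn hN'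
      _ = ε j := ENNReal.add_halves _
  choose nxt h1 h2 h3 using step
  -- A state is (last term chosen, end of its block). Stage `j` starts at the old end, so its term
  -- is the first entry of `st (j + 1)` while its block starts at the second entry of `st j`.
  let st : ℕ → ℕ × ℕ := fun j => Nat.rec (0, 0) (fun j s => nxt j s) j
  refine ⟨fun j => (st (j + 1)).1, fun j => (st j).2, strictMono_nat_of_lt_succ fun j => ?_,
    strictMono_nat_of_lt_succ fun j => ?_, fun j => ?_⟩
  · exact h1 (j + 1) (st (j + 1))
  · exact h2 j (st j)
  · exact h3 j (st j)

theorem block_disjoint {N : ℕ → ℕ} (hN : StrictMono N) (y : ℕ → ℕ → 𝕜) {i j : ℕ} (hij : i ≠ j)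
    (k : ℕ) : block (N i) (N (i + 1)) (y i) k = 0 ∨ block (N j) (N (j + 1)) (y j) k = 0 := by
  by_contra! h
  have hi : N i ≤ k ∧ k < N (i + 1) := by
    by_contra hh
    exact h.1 (if_neg hh)
  have hj : N j ≤ k ∧ k < N (j + 1) := by
    by_contra hh
    exact h.2 (if_neg hh)
  have h1 := hN.lt_iff_lt.1 (hi.1.trans_lt hj.2)
  have h2 := hN.lt_iff_lt.1 (hj.1.trans_lt hi.2)
  omega

theorem powModular_mul_block (hp : ∀ k, 0 < p k) (N N' : ℕ) (y : ℕ → 𝕜) (t : unitInterval) :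
    powModular p (fun k => Real.toNNReal t * ‖block N N' y k‖₊) =
      ENNReal.ofReal ((∑ k ∈ Finset.Ico N N', ‖y k‖ ^ p k • powC (p k)) t) := by
  rw [powModular, tsum_eq_sum (s := Finset.Ico N N'), ContinuousMap.sum_apply,
    ENNReal.ofReal_sum_of_nonneg]
  · refine Finset.sum_congr rfl fun k hk => ?_
    rw [block, if_pos (Finset.mem_Ico.1 hk), ContinuousMap.smul_apply, powC_apply (hp k).le,
      smul_eq_mul, ENNReal.coe_mul, ENNReal.mul_rpow_of_nonneg _ _ (hp k).le,
      ENNReal.ofReal_mul (by positivity), mul_comm, ← ENNReal.ofReal_rpow_of_nonneg t.2.1 (hp k).le,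
      ← ENNReal.ofReal_rpow_of_nonneg (norm_nonneg _) (hp k).le, ofReal_norm]
    rfl
  · intro k _
    exact mul_nonneg (by positivity) (powC_nonneg _ _)
  · intro k hk
    rw [block, if_neg fun h => hk (Finset.mem_Ico.2 h)]
    simp [hp k]

end Modular

end BourginNakano

/-! ### Subsymmetric sequence spaces and a criterion for `S = ℓ_F`. -/

namespace BourginNakano

namespace SequenceSpace

variable {𝕜 : Type*} [RCLike 𝕜] (S : SequenceSpace 𝕜)

/-- The unit vectors of a sequence space. -/
def unit (n : ℕ) : S.carrier :=
  ⟨Pi.single n 1, S.finite_mem _ ((Set.finite_singleton n).subset Pi.support_single_subset)⟩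

/-- The truncation `∑_{j < J} aⱼ eⱼ`. -/
def trunc (a : ℕ → 𝕜) (J : ℕ) : S.carrier := ∑ j ∈ Finset.range J, a j • S.unit j

variable {S}

theorem coe_sum_unit (a : ℕ → 𝕜) (σ : ℕ → ℕ) (J m : ℕ) :
    ((∑ j ∈ Finset.range J, a j • S.unit (σ j) : S.carrier) : ℕ → 𝕜) m =
      ∑ j ∈ Finset.range J, if m = σ j then a j else 0 := by
  rw [Submodule.coe_sum, Finset.sum_apply]
  refine Finset.sum_congr rfl fun j _ => ?_
  simp [unit, Pi.single_apply]

theorem coe_sum_unit_apply (a : ℕ → 𝕜) {σ : ℕ → ℕ} (hσ : σ.Injective) (J i : ℕ) :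
    ((∑ j ∈ Finset.range J, a j • S.unit (σ j) : S.carrier) : ℕ → 𝕜) (σ i) =
      if i < J then a i else 0 := by
  rw [coe_sum_unit]
  simp [hσ.eq_iff]

theorem coe_sum_unit_of_notMem (a : ℕ → 𝕜) {σ : ℕ → ℕ} (J : ℕ) {m : ℕ} (hm : m ∉ range σ) :
    ((∑ j ∈ Finset.range J, a j • S.unit (σ j) : S.carrier) : ℕ → 𝕜) m = 0 := by
  rw [coe_sum_unit]
  exact Finset.sum_eq_zero fun j _ => if_neg fun h => hm ⟨j, h.symm⟩

theorem coe_trunc (a : ℕ → 𝕜) (J i : ℕ) :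
    (S.trunc a J : ℕ → 𝕜) i = if i < J then a i else 0 :=
  coe_sum_unit_apply a Function.injective_id J i

theorem qnorm_neg (f : S.carrier) : S.qnorm (-f) = S.qnorm f := by
  rw [← neg_one_smul 𝕜 f, S.qnorm_smul]
  simp

theorem qnorm_sum_unit (hS : S.IsSubsymmetric) (a : ℕ → 𝕜) {σ : ℕ → ℕ} (hσ : StrictMono σ)
    (J : ℕ) : S.qnorm (∑ j ∈ Finset.range J, a j • S.unit (σ j)) = S.qnorm (S.trunc a J) := by
  obtain ⟨h, hq⟩ := (hS σ hσ).1 (∑ j ∈ Finset.range J, a j • S.unit (σ j)) (by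
    intro m hm
    by_contra hmσ
    exact hm (coe_sum_unit_of_notMem a J hmσ))
  rw [← hq]
  congr 1
  ext i
  rw [coe_trunc]
  exact coe_sum_unit_apply a hσ.injective J i

theorem qnorm_unit (hS : S.IsSubsymmetric) (n : ℕ) : S.qnorm (S.unit n) = S.qnorm (S.unit 0) := by
  have := qnorm_sum_unit hS (fun _ => 1) (σ := fun j => n + j)
    (fun i j h => Nat.add_lt_add_left h n) 1
  simpa [trunc] using this

theorem qnorm_unit_pos : 0 < S.qnorm (S.unit 0) := by
  refine (S.qnorm_nonneg _).lt_of_ne fun h => ?_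
  have h1 := congrArg (fun f : S.carrier => (f : ℕ → 𝕜) 0) ((S.qnorm_eq_zero _).1 h.symm)
  simp [unit] at h1

theorem norm_mul_qnorm_unit_le (hS : S.IsSubsymmetric) (f : S.carrier) (n : ℕ) :
    ‖(f : ℕ → 𝕜) n‖ * S.qnorm (S.unit 0) ≤ S.qnorm f := by
  rw [← qnorm_unit hS n, ← S.qnorm_smul]
  refine S.qnorm_mono _ _ fun m => ?_
  rcases eq_or_ne m n with rfl | h
  · simp [unit]
  · simp [unit, h]

/-- The index sets are disjoint, so deleting the `β`-coordinates only decreases the quasi-norm, and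
subsymmetry moves what is left to the initial segment. -/
theorem le_qnorm_sum_sub (hS : S.IsSubsymmetric) (a : ℕ → 𝕜) {α β : ℕ → ℕ} (hα : StrictMono α)
    (hαβ : ∀ i j, α i ≠ β j) (J : ℕ) :
    S.qnorm (S.trunc a J) ≤
      S.qnorm (∑ j ∈ Finset.range J, a j • (S.unit (α j) - S.unit (β j))) := by
  rw [← qnorm_sum_unit hS a hα J]
  refine S.qnorm_mono _ _ fun m => ?_
  simp_rw [smul_sub]
  rw [Finset.sum_sub_distrib, Submodule.coe_sub, Pi.sub_apply]
  by_cases hm : m ∈ range α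
  · obtain ⟨i, rfl⟩ := hm
    rw [coe_sum_unit_of_notMem (σ := β) a J (fun ⟨j, hj⟩ => hαβ i j hj.symm), sub_zero]
  · rw [coe_sum_unit_of_notMem a J hm, norm_zero]
    exact norm_nonneg _

theorem qnorm_sum_sub_le (hS : S.IsSubsymmetric) {k : ℝ}
    (hk : ∀ f g, S.qnorm (f + g) ≤ k * (S.qnorm f + S.qnorm g)) (a : ℕ → 𝕜) {α β : ℕ → ℕ}
    (hα : StrictMono α) (hβ : StrictMono β) (J : ℕ) :
    S.qnorm (∑ j ∈ Finset.range J, a j • (S.unit (α j) - S.unit (β j))) ≤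
      2 * k * S.qnorm (S.trunc a J) := by
  simp_rw [smul_sub]
  rw [Finset.sum_sub_distrib, sub_eq_add_neg]
  refine (hk _ _).trans (le_of_eq ?_)
  rw [qnorm_neg, qnorm_sum_unit hS a hα, qnorm_sum_unit hS a hβ]
  ring

theorem qnorm_trunc_le (f : S.carrier) (J : ℕ) : S.qnorm (S.trunc f J) ≤ S.qnorm f := by
  refine S.qnorm_mono _ _ fun m => ?_
  rw [coe_trunc]
  split_ifs
  · exact le_rfl
  · simp

theorem exists_mem_of_trunc : ∃ C : ℝ, 0 ≤ C ∧ ∀ (f : ℕ → 𝕜) (B : ℝ),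
    (∀ J, S.qnorm (S.trunc f J) ≤ B) → ∃ h : f ∈ S.carrier, S.qnorm ⟨f, h⟩ ≤ C * B := by
  obtain ⟨C, hC, h⟩ := S.fatou
  refine ⟨C, hC, fun f B hB => h (fun J => S.trunc f J) f B (fun k => ?_)
    (Eventually.of_forall hB)⟩
  refine tendsto_const_nhds.congr' ?_
  filter_upwards [eventually_gt_atTop k] with J hJ
  rw [coe_trunc, if_pos hJ]

/-- Estimates at a single scale suffice: the power-type bound on `F` and the homogeneity of the
quasi-norm carry them to all scales, and the Fatou property carries them from truncations to
infinite sequences. -/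
theorem eqOrlicz_of_trunc {F : ℝ≥0 → ℝ≥0∞} {q : ℝ} (hq : 0 < q)
    (hF : ∀ l : ℝ≥0, l ≤ 1 → ∀ t, F (l * t) ≤ (l : ℝ≥0∞) ^ q * F t)
    {δ : ℝ} (hδ : 0 < δ) {K : ℝ≥0∞} (hK : K ≠ ∞)
    (h1 : ∀ a J, S.qnorm (S.trunc a J) ≤ δ → ∑ j ∈ Finset.range J, F ‖a j‖₊ ≤ K)
    {ε : ℝ≥0} (hε : 0 < ε) {C : ℝ}
    (h2 : ∀ a J, ∑ j ∈ Finset.range J, F ‖a j‖₊ ≤ ε → S.qnorm (S.trunc a J) ≤ C) :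
    S.EqOrlicz F := by
  have hmod : ∀ l : ℝ≥0, l ≤ 1 → ∀ a : ℕ → ℝ≥0, modular (fun _ => F) (fun k => l * a k) ≤
      (l : ℝ≥0∞) ^ q * modular (fun _ => F) a := fun l hl a => by
    rw [modular, modular, ← ENNReal.tsum_mul_left]
    exact ENNReal.tsum_le_tsum fun k => hF l hl _
  have h3 : ∀ f : S.carrier, S.qnorm f ≤ δ →
      modular (fun _ => F) (fun n => ‖(f : ℕ → 𝕜) n‖₊) ≤ K := fun f hf =>
    ENNReal.tsum_le_of_sum_range_le fun J => h1 f J ((qnorm_trunc_le f J).trans hf)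
  obtain ⟨C', hC', h4⟩ := S.exists_mem_of_trunc
  have h5 : ∀ f : ℕ → 𝕜, modular (fun _ => F) (fun n => ‖f n‖₊) ≤ ε →
      ∃ h : f ∈ S.carrier, S.qnorm ⟨f, h⟩ ≤ C' * C := fun f hf =>
    h4 f C fun J => h2 f J ((ENNReal.sum_le_tsum _).trans hf)
  have hsmul : ∀ (c : ℝ≥0) (f : ℕ → 𝕜), (fun n => ‖((((c : ℝ) : 𝕜)) • f) n‖₊) =
      fun n => c * ‖f n‖₊ := fun c f => by
    ext n
    simp
  have hqs : ∀ (c : ℝ≥0) (f : S.carrier), S.qnorm (((c : ℝ) : 𝕜) • f) = c * S.qnorm f :=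
    fun c f => by rw [S.qnorm_smul]; simp
  refine ⟨?_, fun u e hu he => ?_, fun d hd => ?_⟩
  · ext f
    constructor
    · intro hf
      have hpos : 0 < S.qnorm ⟨f, hf⟩ + 1 := add_pos_of_nonneg_of_pos (S.qnorm_nonneg _) one_pos
      have hc : 0 < δ / (S.qnorm ⟨f, hf⟩ + 1) := div_pos hδ hpos
      obtain ⟨c, hcδ⟩ : ∃ c : ℝ≥0, (c : ℝ) = δ / (S.qnorm ⟨f, hf⟩ + 1) := ⟨⟨_, hc.le⟩, rfl⟩
      refine ⟨c, by rw [← hcδ] at hc; exact_mod_cast hc, ?_⟩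
      rw [← hsmul]
      refine (h3 (((c : ℝ) : 𝕜) • ⟨f, hf⟩) ?_).trans_lt hK.lt_top
      rw [hqs, hcδ, div_mul_eq_mul_div, div_le_iff₀ hpos]
      nlinarith
    · rintro ⟨t, ht, hft⟩
      obtain ⟨l, hl, -, h6⟩ := exists_mul_lt_of_scaling hq (fun l hl => hmod l hl _) hft.ne
        (ENNReal.coe_pos.2 hε)
      obtain ⟨h7, -⟩ := h5 ((((l * t : ℝ≥0) : ℝ) : 𝕜) • f) (by
        rw [hsmul]
        simpa [mul_assoc] using h6.le)
      have h8 : (((l * t : ℝ≥0) : ℝ) : 𝕜) ≠ 0 := by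
        rw [RCLike.ofReal_ne_zero]
        exact_mod_cast (mul_pos hl ht).ne'
      exact (S.carrier.smul_mem_iff h8).1 h7
  · obtain ⟨l, hl, hl1, h6⟩ := exists_mul_lt_of_scaling (ρ := fun a => (a 0 : ℝ≥0∞) ^ q * K)
      (a := fun _ => 1) hq
      (fun l hl => by simp) (by simpa using hK) (ENNReal.coe_pos.2 he)
    rw [mul_one] at h6
    refine ⟨δ * (l * u : ℝ≥0), mul_pos hδ (by exact_mod_cast mul_pos hl hu), fun f hf => ?_⟩
    have hlu : 0 < l * u := mul_pos hl hu
    have h7 := h3 (((((l * u)⁻¹ : ℝ≥0) : ℝ) : 𝕜) • f) (by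
      rw [hqs, NNReal.coe_inv, inv_mul_le_iff₀ (by exact_mod_cast hlu), mul_comm]
      exact hf.le)
    have h8 : (fun n => ‖((f : S.carrier) : ℕ → 𝕜) n‖₊ / u) =
        fun n => l * ‖((((((l * u)⁻¹ : ℝ≥0) : ℝ) : 𝕜) • f : S.carrier) : ℕ → 𝕜) n‖₊ := by
      ext n
      rw [Submodule.coe_smul, congrFun (hsmul _ _) n, mul_inv, ← mul_assoc, ← mul_assoc,
        mul_inv_cancel₀ hl.ne', one_mul, div_eq_inv_mul]
    change modular _ _ < _
    rw [h8]
    exact (hmod l hl1 _).trans_lt ((mul_le_mul_right h7 _).trans_lt h6)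
  · have hpos : 0 < |C' * C| + 1 := add_pos_of_nonneg_of_pos (abs_nonneg _) one_pos
    have hu : 0 < d / (|C' * C| + 1) := div_pos hd hpos
    obtain ⟨u, hud⟩ : ∃ u : ℝ≥0, (u : ℝ) = d / (|C' * C| + 1) := ⟨⟨_, hu.le⟩, rfl⟩
    rw [← hud] at hu
    refine ⟨u, ε, by exact_mod_cast hu, hε, fun f hf => ?_⟩
    obtain ⟨h6, h7⟩ := h5 ((((u⁻¹ : ℝ≥0) : ℝ) : 𝕜) • (f : ℕ → 𝕜)) (by
      rw [hsmul]
      simp_rw [← div_eq_inv_mul]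
      exact le_of_lt hf)
    have h8 := hqs u⁻¹ f
    have h9 : S.qnorm ((((u⁻¹ : ℝ≥0) : ℝ) : 𝕜) • f) ≤ C' * C := h7
    rw [h8, NNReal.coe_inv, inv_mul_le_iff₀ hu] at h9
    refine h9.trans_lt ?_
    rw [hud, div_mul_eq_mul_div, div_lt_iff₀ hpos]
    exact mul_lt_mul_of_pos_left ((le_abs_self _).trans_lt (lt_add_one _)) hd

end SequenceSpace

end BourginNakano

/-! ### The Orlicz function of a coordinatewise null sequence. -/

namespace BourginNakano

/-- The extension by `∞` to `[0,∞)` of a function on `[0,1]`. -/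
noncomputable def orliczExt (F : C(unitInterval, ℝ)) (t : ℝ≥0) : ℝ≥0∞ :=
  if t ≤ 1 then ENNReal.ofReal (F (projIcc 0 1 zero_le_one (t : ℝ))) else ∞

theorem orliczExt_toNNReal (F : C(unitInterval, ℝ)) (t : unitInterval) :
    orliczExt F (Real.toNNReal t) = ENNReal.ofReal (F t) := by
  rw [orliczExt, if_pos (Real.toNNReal_le_one.2 t.2.2), Real.coe_toNNReal _ t.2.1, projIcc_val]

theorem isOrlicz_orliczExt {F : C(unitInterval, ℝ)} (h0 : F 0 = 0) (hF : Monotone F) :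
    IsOrlicz (orliczExt F) := by
  have hcont : Continuous fun t : ℝ≥0 =>
      ENNReal.ofReal (F (projIcc 0 1 zero_le_one (t : ℝ))) :=
    ENNReal.continuous_ofReal.comp
      (F.continuous.comp (continuous_projIcc.comp NNReal.continuous_coe))
  refine ⟨fun s t hst => ?_, fun t => ?_, ?_, ?_⟩
  · rw [orliczExt, orliczExt]
    split_ifs with h1 h2
    · exact ENNReal.ofReal_le_ofReal (hF (monotone_projIcc _ (by exact_mod_cast hst)))
    · exact le_top
    · exact absurd (hst.trans ‹_›) h1
    · exact le_rfl
  · by_cases ht : t ≤ 1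
    · refine Tendsto.congr' (f₁ := fun t : ℝ≥0 =>
        ENNReal.ofReal (F (projIcc 0 1 zero_le_one (t : ℝ)))) ?_ ?_
      · filter_upwards [self_mem_nhdsWithin] with s hs
        rw [orliczExt, if_pos ((le_of_lt hs).trans ht)]
      · rw [orliczExt, if_pos ht]
        exact (hcont.tendsto t).mono_left nhdsWithin_le_nhds
    · rw [orliczExt, if_neg ht]
      refine tendsto_const_nhds.congr' ?_
      filter_upwards [nhdsWithin_le_nhds (Ioi_mem_nhds (not_le.1 ht))] with s hs
      rw [orliczExt, if_neg (not_le.2 hs)]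
  · refine Tendsto.congr' (f₁ := fun t : ℝ≥0 =>
      ENNReal.ofReal (F (projIcc 0 1 zero_le_one (t : ℝ)))) ?_ ?_
    · filter_upwards [nhdsWithin_le_nhds (Iio_mem_nhds (zero_lt_one (α := ℝ≥0)))] with s hs
      rw [orliczExt, if_pos (le_of_lt hs)]
    · have := (hcont.tendsto 0).mono_left (nhdsWithin_le_nhds (s := Ioi 0))
      have h1 : projIcc (0 : ℝ) 1 zero_le_one ((0 : ℝ≥0) : ℝ) = (0 : unitInterval) := by
        rw [NNReal.coe_zero]
        exact projIcc_left _
      rwa [h1, h0, ENNReal.ofReal_zero] at this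
  · refine lt_of_lt_of_le ?_ (le_iSup _ (2 : ℝ≥0))
    rw [orliczExt, if_neg (by norm_num)]
    exact ENNReal.zero_lt_top

theorem orliczExt_mul_le {F : C(unitInterval, ℝ)} (h0 : F 0 = 0) {q : ℝ} (hq : 0 < q)
    (hF : ∀ l t, F (l * t) ≤ (l : ℝ) ^ q * F t) (l : ℝ≥0) (hl : l ≤ 1) (t : ℝ≥0) :
    orliczExt F (l * t) ≤ (l : ℝ≥0∞) ^ q * orliczExt F t := by
  have hz : orliczExt F 0 = 0 := by
    simpa [h0] using orliczExt_toNNReal F 0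
  rcases eq_zero_or_pos l with rfl | hl0
  · simp [hz]
  by_cases ht : t ≤ 1
  · have key := hF ⟨l, l.2, hl⟩ ⟨t, t.2, ht⟩
    have h1 := orliczExt_toNNReal F (⟨l, l.2, hl⟩ * ⟨t, t.2, ht⟩)
    have h2 := orliczExt_toNNReal F ⟨t, t.2, ht⟩
    have h3 : Real.toNNReal ((⟨l, l.2, hl⟩ * ⟨t, t.2, ht⟩ : unitInterval) : ℝ) = l * t := by
      change Real.toNNReal ((l : ℝ) * t) = _
      rw [← NNReal.coe_mul, Real.toNNReal_coe]
    rw [h3] at h1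
    simp only [Real.toNNReal_coe] at h2
    rw [h1, h2]
    refine (ENNReal.ofReal_le_ofReal key).trans (le_of_eq ?_)
    change ENNReal.ofReal ((l : ℝ) ^ q * _) = _
    rw [ENNReal.ofReal_mul (Real.rpow_nonneg l.coe_nonneg _),
      ← ENNReal.ofReal_rpow_of_nonneg l.coe_nonneg hq.le, ENNReal.ofReal_coe_nnreal]
  · rw [orliczExt.eq_def F t, if_neg ht, ENNReal.mul_top]
    · exact le_top
    · exact (ENNReal.rpow_pos (by exact_mod_cast hl0) ENNReal.coe_ne_top).ne'

theorem powModular_block_one {𝕜 : Type*} [RCLike 𝕜] {p : ℕ → ℝ} (hp : ∀ k, 0 < p k) (N N' : ℕ)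
    (y : ℕ → 𝕜) : powModular p (fun k => ‖block N N' y k‖₊) =
      ENNReal.ofReal (∑ k ∈ Finset.Ico N N', ‖y k‖ ^ p k) := by
  have := powModular_mul_block hp N N' y 1
  simpa [ContinuousMap.sum_apply, powC] using this

theorem sum_geometric_le (η : ℝ≥0∞) (J : ℕ) :
    ∑ j ∈ Finset.range J, η * 2⁻¹ ^ (j + 1) ≤ η := by
  refine (ENNReal.sum_le_tsum _).trans (le_of_eq ?_)
  rw [ENNReal.tsum_mul_left, ENNReal.tsum_geometric_add_one, ENNReal.one_sub_inv_two, inv_inv,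
    ENNReal.inv_mul_cancel two_ne_zero ENNReal.ofNat_ne_top, mul_one]

theorem powModular_block_le {𝕜 : Type*} [RCLike 𝕜] {p : ℕ → ℝ} (hp : ∀ k, 0 < p k) (N N' : ℕ)
    (y : ℕ → 𝕜) : powModular p (fun k => ‖block N N' y k‖₊) ≤ powModular p (fun k => ‖y k‖₊) := by
  refine powModular_mono hp fun k => ?_
  rw [block]
  split_ifs
  · exact le_rfl
  · simp

/-- Up to small perturbations the `y (n j)` are disjoint blocks on which the modular is a sum of
functions of `|a_j|`, all close to one `F`. -/
theorem exists_orlicz_of_null {𝕜 : Type*} [RCLike 𝕜] {p : ℕ → ℝ} {pm pM : ℝ} (hpm : 0 < pm)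
    (hp1 : ∀ k, pm ≤ p k) (hp2 : ∀ k, p k ≤ pM) (y : ℕ → ℕ → 𝕜)
    (hy : ∀ k, Tendsto (fun n => y n k) atTop (𝓝 0)) {v : ℝ≥0∞} {V : ℝ≥0} (hv : 0 < v)
    (hyv : ∀ n, v ≤ powModular p (fun k => ‖y n k‖₊))
    (hyV : ∀ n, powModular p (fun k => ‖y n k‖₊) ≤ V) :
    ∃ n : ℕ → ℕ, StrictMono n ∧ ∃ F : C(unitInterval, ℝ),
      F 0 = 0 ∧ Monotone F ∧ (∀ l t, F (l * t) ≤ (l : ℝ) ^ pm * F t) ∧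
      (∃ r, 0 < r ∧ MapClusterPt r atTop p ∧ ∀ x > r,
        ∃ κ ∈ classK (closure (range fun k => ENNReal.ofReal (p k)) ∩
          Icc (ENNReal.ofReal r) (ENNReal.ofReal x)),
        ∃ a b : ℝ, 0 < a ∧ 0 < b ∧ ∀ t, a * κ t ≤ F t ∧ F t ≤ b * κ t) ∧
      ∃ (η : ℝ≥0) (K : ℝ≥0∞), 0 < η ∧ K ≠ ∞ ∧ ∀ (a : ℕ → 𝕜) (J : ℕ), (∀ j < J, ‖a j‖₊ ≤ 1) →
        (powModular p (fun k => ‖∑ j ∈ Finset.range J, a j * y (n j) k‖₊) < 1 →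
          ∑ j ∈ Finset.range J, orliczExt F ‖a j‖₊ ≤ K) ∧
        (∑ j ∈ Finset.range J, orliczExt F ‖a j‖₊ ≤ η →
          powModular p (fun k => ‖∑ j ∈ Finset.range J, a j * y (n j) k‖₊) < 1) := by
  have hp : ∀ k, 0 < p k := fun k => hpm.trans_le (hp1 k)
  set D : ℝ≥0∞ := 2 ^ pM with hD
  have hpM : 0 < pM := (hp 0).trans_le (hp2 0)
  have hDt : D ≠ ∞ := ENNReal.rpow_ne_top_of_nonneg hpM.le ENNReal.ofNat_ne_top
  have hD1 : 1 ≤ D := ENNReal.one_le_rpow (by norm_num) hpM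
  have hD0 : D ≠ 0 := (zero_lt_one.trans_le hD1).ne'
  -- The bound by `v` keeps the modular of each block at least `η`; the bound by `1` leaves room for
  -- three errors of size `η` in the last estimate.
  obtain ⟨η, hη0, hη⟩ := ENNReal.exists_nnreal_pos_mul_lt (a := D * 4) (b := min 1 v)
    (ENNReal.mul_ne_top hDt ENNReal.ofNat_ne_top) (lt_min zero_lt_one hv).ne'
  have hη1 : D * (4 * η) < 1 := by
    rw [← mul_assoc, mul_comm]; exact hη.trans_le (min_le_left _ _)
  have hηv : D * (4 * η) < v := by
    rw [← mul_assoc, mul_comm]; exact hη.trans_le (min_le_right _ _)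
  -- The powers of `D⁻¹` cancel the constants of `powModular_sum_le`; the powers of `2⁻¹` make the
  -- total error at most `η`. Decrease in `j` keeps this valid on subsequences.
  set ε : ℕ → ℝ≥0∞ := fun j => η * (2⁻¹ * D⁻¹) ^ (j + 1) with hε
  have hε0 : ∀ j, 0 < ε j := fun j => by
    have h1 : (0 : ℝ≥0∞) < 2⁻¹ * D⁻¹ :=
      ENNReal.mul_pos (ENNReal.inv_ne_zero.2 ENNReal.ofNat_ne_top) (ENNReal.inv_ne_zero.2 hDt)
    exact ENNReal.mul_pos (by exact_mod_cast hη0.ne') (pow_ne_zero _ h1.ne')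
  have hbase : (2⁻¹ * D⁻¹ : ℝ≥0∞) ≤ 1 :=
    mul_le_one' (ENNReal.inv_le_one.2 (by norm_num)) (ENNReal.inv_le_one.2 hD1)
  have hεη : ∀ j, ε j ≤ η := fun j => mul_le_of_le_one_right' (pow_le_one' hbase _)
  have hεD : ∀ i j, i ≤ j → D ^ (i + 1) * ε j ≤ η * 2⁻¹ ^ (i + 1) := fun i j hij => by
    have h1 : ε j ≤ ε i := mul_le_mul_right
      (pow_le_pow_right_of_le_one' hbase (Nat.add_le_add_right hij 1)) _
    refine (mul_le_mul_right h1 _).trans (le_of_eq ?_)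
    simp only [hε]
    rw [mul_pow, ← mul_assoc, ← mul_assoc, mul_comm (D ^ (i + 1)), mul_right_comm,
      mul_assoc (η : ℝ≥0∞) (D ^ (i + 1)), ← mul_pow, ENNReal.mul_inv_cancel hD0 hDt, one_pow,
      mul_one]
  obtain ⟨n, N, hn, hN, hapx⟩ := exists_block_approx hp y hy
    (fun n => ne_top_of_le_ne_top ENNReal.coe_ne_top (hyV n)) ε hε0
  set z : ℕ → ℕ → 𝕜 := fun j => block (N j) (N (j + 1)) (y (n j)) with hz
  have hzm : ∀ j, (η : ℝ≥0∞) ≤ powModular p (fun k => ‖z j k‖₊) := fun j => by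
    by_contra! hlt
    have h1 : powModular p (fun k => ‖y (n j) k‖₊) ≤ D * (η + η) := by
      refine (powModular_mono hp (b := fun k => ‖z j k‖₊ + ‖y (n j) k - z j k‖₊) fun k => ?_).trans
        ((powModular_add_le hp hp2 _ _).trans ?_)
      · simpa using nnnorm_add_le (z j k) (y (n j) k - z j k)
      · gcongr
        exact (hapx j).le.trans (hεη j)
    refine absurd ((hyv _).trans h1) (not_le.2 (lt_of_le_of_lt ?_ hηv))
    gcongr
    rw [← two_mul]
    gcongr
    norm_num
  obtain ⟨F, hFfreq, hF0, hFmono, hFscal, hFr⟩ := exists_limit_of_weights hpm hp1 hp2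
    (fun j => Finset.Ico (N j) (N (j + 1))) (fun j k => ‖y (n j) k‖ ^ p k)
    (fun j k => Real.rpow_nonneg (norm_nonneg _) _) (m := η) (M := V) (by exact_mod_cast hη0)
    (fun j => by
      have := hzm j
      rw [hz, powModular_block_one hp, ← ENNReal.ofReal_coe_nnreal] at this
      exact (ENNReal.ofReal_le_ofReal_iff
        (Finset.sum_nonneg fun k _ => Real.rpow_nonneg (norm_nonneg _) _)).1 this)
    (fun j => by
      have := (powModular_block_le hp (N j) (N (j + 1)) _).trans (hyV (n j))
      rw [powModular_block_one hp, ← ENNReal.ofReal_coe_nnreal] at this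
      exact (ENNReal.ofReal_le_ofReal_iff V.2).1 this)
    (fun M => by
      filter_upwards [eventually_ge_atTop M] with j hj k hk
      exact (hj.trans (hN.le_apply)).trans (Finset.mem_Ico.1 hk).1)
  obtain ⟨ψ, hψ, hψF⟩ := extraction_forall_of_frequently fun j : ℕ =>
    hFfreq ((η : ℝ) * 2⁻¹ ^ (j + 1)) (by positivity)
  have hFzero : F 0 = 0 := by
    refine le_antisymm ?_ (hF0 0)
    simpa [Real.zero_rpow hpm.ne'] using hFscal 0 0
  have hcomp : ∀ (j : ℕ) (t : ℝ≥0), t ≤ 1 →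
      orliczExt F t ≤ powModular p (fun k => t * ‖z (ψ j) k‖₊) + η * 2⁻¹ ^ (j + 1) ∧
      powModular p (fun k => t * ‖z (ψ j) k‖₊) ≤ orliczExt F t + η * 2⁻¹ ^ (j + 1) := by
    intro j t ht
    obtain ⟨x, rfl⟩ : ∃ x : unitInterval, Real.toNNReal x = t := ⟨⟨t, t.2, ht⟩, by simp⟩
    rw [orliczExt_toNNReal, hz, powModular_mul_block hp]
    have h1 := (ContinuousMap.norm_coe_le_norm _ x).trans (hψF j).le
    rw [ContinuousMap.sub_apply, Real.norm_eq_abs, abs_le] at h1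
    have he : (η : ℝ≥0∞) * 2⁻¹ ^ (j + 1) = ENNReal.ofReal (η * 2⁻¹ ^ (j + 1)) := by
      rw [ENNReal.ofReal_mul η.coe_nonneg, ENNReal.ofReal_pow (by norm_num),
        ENNReal.ofReal_inv_of_pos two_pos]
      simp
    rw [he, ← ENNReal.ofReal_add (hF0 x) (by positivity), ← ENNReal.ofReal_add _ (by positivity)]
    · exact ⟨ENNReal.ofReal_le_ofReal (by linarith), ENNReal.ofReal_le_ofReal (by linarith)⟩
    · rw [ContinuousMap.sum_apply]
      exact Finset.sum_nonneg fun k _ => mul_nonneg (by positivity) (powC_nonneg _ _)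
  refine ⟨n ∘ ψ, hn.comp hψ, F, hFzero, hFmono, hFscal, hFr, η, D * (1 + η) + η, hη0, ?_, ?_⟩
  · exact ENNReal.add_ne_top.2 ⟨ENNReal.mul_ne_top hDt
      (ENNReal.add_ne_top.2 ⟨ENNReal.one_ne_top, ENNReal.coe_ne_top⟩), ENNReal.coe_ne_top⟩
  intro a J ha
  have herr : powModular p
      (fun k => ‖∑ j ∈ Finset.range J, a j * (y (n (ψ j)) k - z (ψ j) k)‖₊) ≤ η := by
    refine (powModular_sum_le hp hp2 J fun j k => a j * (y (n (ψ j)) k - z (ψ j) k)).trans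
      ((Finset.sum_le_sum fun j hj => ?_).trans (sum_geometric_le η J))
    refine le_trans (mul_le_mul_right ?_ _) (hεD j (ψ j) hψ.le_apply)
    refine (powModular_mono hp fun k => ?_).trans (hapx (ψ j)).le
    rw [nnnorm_mul]
    exact mul_le_of_le_one_left' (ha j (Finset.mem_range.1 hj))
  have hdisj : powModular p (fun k => ‖∑ j ∈ Finset.range J, a j * z (ψ j) k‖₊) =
      ∑ j ∈ Finset.range J, powModular p (fun k => ‖a j‖₊ * ‖z (ψ j) k‖₊) := by
    rw [powModular_sum_disjoint hp J fun j k => a j * z (ψ j) k]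
    · simp_rw [nnnorm_mul]
    · intro i j hij k
      exact (block_disjoint hN (fun j => y (n j)) (hψ.injective.ne hij) k).imp
        (fun h => by change a i * block _ _ _ k = 0; rw [h, mul_zero])
        (fun h => by change a j * block _ _ _ k = 0; rw [h, mul_zero])
  constructor
  · intro h
    have h1 : ∑ j ∈ Finset.range J, powModular p (fun k => ‖a j‖₊ * ‖z (ψ j) k‖₊) ≤
        D * (1 + η) := by
      rw [← hdisj]
      refine (powModular_mono hp fun k => ?_).trans ((powModular_add_le hp hp2 _ _).trans
        (mul_le_mul_right (add_le_add h.le herr) _))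
      refine le_trans (le_of_eq ?_) (nnnorm_sub_le _ _)
      simp_rw [mul_sub, Finset.sum_sub_distrib]
      simp
    refine (Finset.sum_le_sum fun j hj =>
      (hcomp j ‖a j‖₊ (ha j (Finset.mem_range.1 hj))).1).trans ?_
    rw [Finset.sum_add_distrib]
    exact add_le_add h1 (sum_geometric_le η J)
  · intro h
    have h1 : ∑ j ∈ Finset.range J, powModular p (fun k => ‖a j‖₊ * ‖z (ψ j) k‖₊) ≤ η + η := by
      refine (Finset.sum_le_sum fun j hj =>
        (hcomp j ‖a j‖₊ (ha j (Finset.mem_range.1 hj))).2).trans ?_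
      rw [Finset.sum_add_distrib]
      exact add_le_add h (sum_geometric_le η J)
    rw [← hdisj] at h1
    refine lt_of_le_of_lt ((powModular_mono hp fun k => ?_).trans ((powModular_add_le hp hp2 _ _).trans
      (mul_le_mul_right (add_le_add h1 herr) _))) (lt_of_le_of_lt ?_ hη1)
    · refine le_trans (le_of_eq ?_) (nnnorm_add_le _ _)
      simp_rw [mul_sub, Finset.sum_sub_distrib]
      simp
    · gcongr
      rw [show (η : ℝ≥0∞) + η + η = 3 * η by ring]
      gcongr
      norm_num

end BourginNakano

/-! ### From the embedding to the Orlicz function. -/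

namespace BourginNakano

theorem exists_null_differences {𝕜 : Type*} [RCLike 𝕜] (x : ℕ → ℕ → 𝕜) {B : ℝ}
    (hB : ∀ n k, ‖x n k‖ ≤ B) : ∃ α β : ℕ → ℕ, StrictMono α ∧ StrictMono β ∧
      (∀ i j, α i ≠ β j) ∧ ∀ k, Tendsto (fun n => x (α n) k - x (β n) k) atTop (𝓝 0) := by
  have hc : IsCompact (Set.univ.pi fun _ : ℕ => Metric.closedBall (0 : 𝕜) B) :=
    isCompact_univ_pi fun _ => isCompact_closedBall 0 B
  obtain ⟨x0, -, σ, hσ, hlim⟩ := hc.tendsto_subseq (x := x) fun n k _ => by simpa using hB n k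
  -- Even and odd terms of one convergent subsequence have the same limit and disjoint index sets.
  have h1 : StrictMono fun n : ℕ => 2 * n := fun i j h => by dsimp only; omega
  have h2 : StrictMono fun n : ℕ => 2 * n + 1 := fun i j h => by dsimp only; omega
  refine ⟨fun n => σ (2 * n), fun n => σ (2 * n + 1), hσ.comp h1, hσ.comp h2, fun i j h => ?_,
    fun k => ?_⟩
  · have := hσ.injective h
    omega
  · have h3 := tendsto_pi_nhds.1 hlim k
    simpa using (h3.comp h1.tendsto_atTop).sub (h3.comp h2.tendsto_atTop)

theorem exists_eqOrlicz {𝕜 : Type*} [RCLike 𝕜] {S : SequenceSpace 𝕜} (hS : S.IsSubsymmetric)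
    {p : ℕ → ℝ} {pm pM : ℝ} (hpm : 0 < pm) (hp1 : ∀ k, pm ≤ p k) (hp2 : ∀ k, p k ≤ pM)
    (T : S.carrier →ₗ[𝕜] (ℕ → 𝕜)) {a b : ℝ} (ha : 0 < a) (hb : 0 < b)
    (hT1 : ∀ f, b * S.qnorm f < 1 → powModular p (fun k => ‖T f k‖₊) < 1)
    (hT2 : ∀ f, powModular p (fun k => ‖T f k‖₊) < 1 → a * S.qnorm f ≤ 1) :
    ∃ F : C(unitInterval, ℝ), F 0 = 0 ∧ Monotone F ∧ S.EqOrlicz (orliczExt F) ∧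
      ∃ r, 0 < r ∧ MapClusterPt r atTop p ∧ ∀ x > r,
        ∃ κ ∈ classK (closure (range fun k => ENNReal.ofReal (p k)) ∩
          Icc (ENNReal.ofReal r) (ENNReal.ofReal x)),
        ∃ a b : ℝ, 0 < a ∧ 0 < b ∧ ∀ t, a * κ t ≤ F t ∧ F t ≤ b * κ t := by
  have hp : ∀ k, 0 < p k := fun k => hpm.trans_le (hp1 k)
  have hq0 := S.qnorm_unit_pos
  have hqs : ∀ (c : ℝ≥0) (f : S.carrier), S.qnorm (((c : ℝ) : 𝕜) • f) = c * S.qnorm f :=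
    fun c f => by rw [S.qnorm_smul]; simp
  have hTs : ∀ (c : ℝ≥0) (f : S.carrier), (fun k => ‖T (((c : ℝ) : 𝕜) • f) k‖₊) =
      fun k => c * ‖T f k‖₊ := fun c f => by ext k; simp [norm_smul]
  have hupper : ∀ L : ℝ, 0 ≤ L → ∃ c : ℝ≥0, 1 ≤ c ∧ ∀ f, S.qnorm f ≤ L →
      powModular p (fun k => c⁻¹ * ‖T f k‖₊) < 1 := by
    intro L hL
    obtain ⟨c, hc⟩ : ∃ c : ℝ≥0, (c : ℝ) = b * L + 1 := ⟨⟨b * L + 1, by positivity⟩, rfl⟩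
    have hbL : 0 ≤ b * L := by positivity
    have hc1 : (1 : ℝ) ≤ c := by rw [hc]; linarith
    refine ⟨c, by exact_mod_cast hc1, fun f hf => ?_⟩
    rw [← hTs]
    refine hT1 _ ?_
    rw [hqs, NNReal.coe_inv, mul_left_comm, inv_mul_lt_iff₀ (by linarith), hc]
    have := mul_le_mul_of_nonneg_left hf hb.le
    linarith
  obtain ⟨c0, hc01, hc0⟩ := hupper (S.qnorm (S.unit 0)) hq0.le
  obtain ⟨α, β, hα, hβ, hαβ, hnull⟩ := exists_null_differences (fun n => T (S.unit n))
    (B := c0) fun n k => by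
      have h1 := hc0 (S.unit n) (S.qnorm_unit hS n).le
      have h2 : ((c0⁻¹ * ‖T (S.unit n) k‖₊ : ℝ≥0) : ℝ≥0∞) ^ p k < 1 :=
        (ENNReal.le_tsum k).trans_lt h1
      have h3 : c0⁻¹ * ‖T (S.unit n) k‖₊ < 1 := by
        by_contra! h
        exact absurd h2 (not_lt.2 (ENNReal.one_le_rpow (by exact_mod_cast h) (hp k)))
      rw [inv_mul_lt_iff₀ (by positivity), mul_one] at h3
      exact_mod_cast h3.le
  obtain ⟨k, hk0, hk⟩ : ∃ k : ℝ, 0 ≤ k ∧ ∀ f g, S.qnorm (f + g) ≤ k * (S.qnorm f + S.qnorm g) := by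
    obtain ⟨k, hk⟩ := S.qnorm_add
    exact ⟨|k|, abs_nonneg k, fun f g => (hk f g).trans (mul_le_mul_of_nonneg_right (le_abs_self k)
      (add_nonneg (S.qnorm_nonneg f) (S.qnorm_nonneg g)))⟩
  set y : ℕ → ℕ → 𝕜 := fun n => T (S.unit (α n) - S.unit (β n)) with hy
  obtain ⟨c1, hc11, hc1⟩ := hupper (2 * k * S.qnorm (S.unit 0)) (by positivity)
  have hyV : ∀ n, powModular p (fun k => ‖y n k‖₊) ≤ (c1 ^ pM : ℝ≥0) := fun n => by
    have h1 := hc1 (S.unit (α n) - S.unit (β n)) (by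
      rw [sub_eq_add_neg]
      refine (hk _ _).trans (le_of_eq ?_)
      rw [S.qnorm_neg, S.qnorm_unit hS (α n), S.qnorm_unit hS (β n)]
      ring)
    have h2 := powModular_mul_le_of_one_le hp hp2 hc11 (fun k => c1⁻¹ * ‖y n k‖₊)
    have hc10 : c1 ≠ 0 := (zero_lt_one.trans_le hc11).ne'
    simp_rw [← mul_assoc, mul_inv_cancel₀ hc10, one_mul] at h2
    refine h2.trans ?_
    rw [ENNReal.coe_rpow_of_ne_zero hc10]
    exact mul_le_of_le_one_right' h1.le
  -- The difference has a coordinate equal to `1`, hence quasi-norm at least that of a unit vector.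
  -- Scaled by `c`, it violates the conclusion of `hT2`, so its modular is at least `1`; undoing the
  -- scaling costs `c ^ pM`.
  obtain ⟨v, hv, hyv⟩ : ∃ v : ℝ≥0∞, 0 < v ∧ ∀ n, v ≤ powModular p (fun k => ‖y n k‖₊) := by
    have hpos : 0 < (a * S.qnorm (S.unit 0))⁻¹ := by positivity
    obtain ⟨c, hc⟩ : ∃ c : ℝ≥0, (c : ℝ) = (a * S.qnorm (S.unit 0))⁻¹ + 1 :=
      ⟨⟨_, by positivity⟩, rfl⟩
    have hc1 : (1 : ℝ) ≤ c := by linarith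
    have hc1' : 1 ≤ c := by exact_mod_cast hc1
    refine ⟨((c : ℝ≥0∞) ^ pM)⁻¹, ENNReal.inv_pos.2 (ENNReal.rpow_ne_top_of_nonneg
      ((hp 0).le.trans (hp2 0)) ENNReal.coe_ne_top), fun n => ?_⟩
    rw [ENNReal.inv_le_iff_le_mul]
    · refine le_trans ?_ (powModular_mul_le_of_one_le hp hp2 hc1' _)
      rw [← hTs]
      by_contra! hlt
      have h1 := hT2 _ hlt
      have h2 := S.norm_mul_qnorm_unit_le hS (S.unit (α n) - S.unit (β n)) (α n)
      have h3 : ((S.unit (α n) - S.unit (β n) : S.carrier) : ℕ → 𝕜) (α n) = 1 := by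
        simp [SequenceSpace.unit, hαβ n n]
      rw [h3, norm_one, one_mul] at h2
      rw [hqs] at h1
      have h4 : (1 : ℝ) < c * (a * S.qnorm (S.unit 0)) := by
        rw [hc, add_mul, inv_mul_cancel₀ (by positivity)]
        have : 0 < a * S.qnorm (S.unit 0) := by positivity
        linarith
      have h5 := mul_le_mul_of_nonneg_left h2 (mul_nonneg c.coe_nonneg ha.le)
      linarith
    · exact fun _ => (ENNReal.rpow_pos (by exact_mod_cast zero_lt_one.trans_le hc1')
        ENNReal.coe_ne_top).ne'
    · exact fun h => absurd h (ENNReal.rpow_ne_top_of_nonneg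
        ((hp 0).le.trans (hp2 0)) ENNReal.coe_ne_top)
  obtain ⟨n, hn, F, hF0, hFmono, hFscal, hFr, η, K, hη, hK, hcmp⟩ := exists_orlicz_of_null hpm hp1
    hp2 y (by simpa [hy] using hnull) hv hyv hyV
  refine ⟨F, hF0, hFmono, ?_, hFr⟩
  have hTsum : ∀ (u : ℕ → 𝕜) (J : ℕ), (fun k => ‖T (∑ j ∈ Finset.range J,
      u j • (S.unit ((α ∘ n) j) - S.unit ((β ∘ n) j))) k‖₊) =
        fun k => ‖∑ j ∈ Finset.range J, u j * y (n j) k‖₊ := fun u J => by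
    ext k
    simp [hy]
  -- The first bound forces all coefficients into the unit ball, where `F` lives; the second makes
  -- `b` times the norm of the sum of differences less than `1`.
  have hδ : 0 < min (S.qnorm (S.unit 0)) (b * (2 * k + 1) + 1)⁻¹ := lt_min hq0 (by positivity)
  refine SequenceSpace.eqOrlicz_of_trunc hpm (orliczExt_mul_le hF0 hpm hFscal) hδ hK ?_ hη
    (C := a⁻¹) ?_
  · intro u J hu
    have hu1 : ∀ j < J, ‖u j‖₊ ≤ 1 := fun j hj => by
      have h1 := (S.norm_mul_qnorm_unit_le hS (S.trunc u J) j).trans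
        (hu.trans (min_le_left _ _))
      rw [S.coe_trunc, if_pos hj] at h1
      exact_mod_cast (mul_le_iff_le_one_left hq0).1 h1
    refine (hcmp u J hu1).1 ?_
    rw [← hTsum]
    refine hT1 _ ?_
    have h1 := S.qnorm_sum_sub_le hS hk u (hα.comp hn) (hβ.comp hn) J
    have h2 := hu.trans (min_le_right _ _)
    have hpos : 0 < b * (2 * k + 1) + 1 := by positivity
    have h3 : b * (2 * k) * (b * (2 * k + 1) + 1)⁻¹ < 1 := by
      rw [mul_inv_lt_iff₀ hpos]
      linarith
    calc b * _ ≤ b * (2 * k * S.qnorm (S.trunc u J)) := mul_le_mul_of_nonneg_left h1 hb.le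
      _ = b * (2 * k) * S.qnorm (S.trunc u J) := by ring
      _ ≤ b * (2 * k) * (b * (2 * k + 1) + 1)⁻¹ := mul_le_mul_of_nonneg_left h2 (by positivity)
      _ < 1 := h3
  · intro u J hu
    -- The value `∞` of `orliczExt` beyond `1` is what forces this.
    have hu1 : ∀ j < J, ‖u j‖₊ ≤ 1 := fun j hj => by
      have h1 : orliczExt F ‖u j‖₊ ≠ ∞ := ne_top_of_le_ne_top ENNReal.coe_ne_top
        ((Finset.single_le_sum (f := fun j => orliczExt F ‖u j‖₊) (fun _ _ => zero_le)
          (Finset.mem_range.2 hj)).trans hu)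
      by_contra h
      exact h1 (if_neg h)
    have h1 := (hcmp u J hu1).2 hu
    rw [← hTsum] at h1
    have h2 := hT2 _ h1
    have h3 := S.le_qnorm_sum_sub hS u (hα.comp hn) (β := β ∘ n) (fun i j => hαβ _ _) J
    refine h3.trans ?_
    rw [← one_div, le_div_iff₀ ha, mul_comm]
    exact h2

end BourginNakano

theorem mainTheorem5 {𝕜 : Type*} [RCLike 𝕜] (P : ℕ → ℝ≥0∞) (hP : ∀ n, 0 < P n)
    (hPminus : 0 < sInf (BourginNakano.essRange P))
    (hPplus : sSup (BourginNakano.essRange P) < ∞)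
    (S : BourginNakano.SequenceSpace 𝕜) (hS : S.IsSubsymmetric) (hemb : S.EmbedsInto P) :
    ∃ r ∈ BourginNakano.limitPoints P, ∃ F : ℝ≥0 → ℝ≥0∞, BourginNakano.IsOrlicz F ∧
      S.EqOrlicz F ∧
      ∀ s : ℝ≥0∞, r < s → F ∈ BourginNakano.classO (BourginNakano.essRange P ∩ Set.Icc r s) := by
  have hmem : ∀ k, P k ∈ BourginNakano.essRange P := fun k => by
    rw [BourginNakano.essRange_eq_closure]
    exact subset_closure ⟨k, rfl⟩
  have hle : ∀ k, P k ≤ sSup (BourginNakano.essRange P) := fun k => le_sSup (hmem k)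
  have hge : ∀ k, sInf (BourginNakano.essRange P) ≤ P k := fun k => sInf_le (hmem k)
  have hfin : ∀ k, P k ≠ ∞ := fun k => ne_top_of_le_ne_top hPplus.ne (hle k)
  have hPm : sInf (BourginNakano.essRange P) ≠ ∞ := ne_top_of_le_ne_top (hfin 0) (hge 0)
  have hpm : 0 < (sInf (BourginNakano.essRange P)).toReal := ENNReal.toReal_pos hPminus.ne' hPm
  have hp1 : ∀ k, (sInf (BourginNakano.essRange P)).toReal ≤ (P k).toReal := fun k =>
    ENNReal.toReal_mono (hfin k) (hge k)
  have hp2 : ∀ k, (P k).toReal ≤ (sSup (BourginNakano.essRange P)).toReal := fun k =>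
    ENNReal.toReal_mono hPplus.ne (hle k)
  have hPo : (fun k => ENNReal.ofReal (P k).toReal) = P :=
    funext fun k => ENNReal.ofReal_toReal (hfin k)
  obtain ⟨T, hTm, a, b, ha, hb, hT⟩ := hemb
  obtain ⟨F, hF0, hFmono, hSF, r, hr, hclus, hK⟩ :=
    BourginNakano.exists_eqOrlicz hS hpm hp1 hp2 T ha hb
      (fun f hf => BourginNakano.powModular_lt_one_of_luxemburg_lt_one hfin hpm hp1 (hTm f)
        (by exact_mod_cast (hT f).2.trans_lt hf))
      (fun f hf => (hT f).1.trans (by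
        exact_mod_cast BourginNakano.luxemburg_le_one_of_powModular_lt_one hfin hf))
  have horl := BourginNakano.isOrlicz_orliczExt hF0 hFmono
  rw [hPo, ← BourginNakano.essRange_eq_closure] at hK
  refine ⟨ENNReal.ofReal r, ?_, BourginNakano.orliczExt F, horl, hSF, fun s hs => ⟨horl, ?_⟩⟩
  · have := hclus.continuousAt_comp ENNReal.continuous_ofReal.continuousAt
    rw [Function.comp_def, hPo] at this
    exact this
  · obtain ⟨x, hx, hxs⟩ : ∃ x > r, ENNReal.ofReal x ≤ s := by
      obtain ⟨x, hx1, hx2⟩ := ENNReal.lt_iff_exists_nnreal_btwn.1 hs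
      refine ⟨x, ?_, by simpa using hx2.le⟩
      rw [← ENNReal.ofReal_coe_nnreal] at hx1
      exact ((ENNReal.ofReal_lt_ofReal_iff_of_nonneg hr.le).1 hx1)
    obtain ⟨κ, hκ, A, B, hA, hB, hAB⟩ := hK x hx
    refine ⟨1, one_pos, le_rfl, κ, BourginNakano.classK_mono
      (inter_subset_inter_right _ (Icc_subset_Icc_right hxs)) hκ, A, B, hA, hB, fun t _ => ?_⟩
    rw [BourginNakano.orliczExt_toNNReal]
    exact ⟨ENNReal.ofReal_le_ofReal (hAB t).1, ENNReal.ofReal_le_ofReal (hAB t).2⟩
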